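/- Let $m\ge 2$, $p\mid m$, and let $V=\mathbb C^n$ carry its standard hermitian form and orthonormal basis $e_1,\dots,e_n$. Let $G=G(m,p,n)$ be the group of all linear maps $e_i\mapsto\theta(i)e_{\sigma(i)}$ with $\sigma\in\mathrm{Sym}(n)$, $\theta(i)^m=1$ and $\prod_i\theta(i)^{m/p}=1$. Let $1\le n_0<n$, let $\lambda=(n_1,\dots,n_d)$ be a partition of $n-n_0$ ($n_1\ge\dots\ge n_d\ge1$), cut $\{n_0+1,\dots,n\}$ into consecutive intervals of sizes $n_1,\dots,n_d$, and let $P=P_{(n_0,\lambda)}=P_0\times P_1$ be the standard parabolic subgroup, where $P_0=G(m,p,n_0)$ acts on the span of $e_1,\dots,e_{n_0}$ (and fixes the other $e_i$) and $P_1=\prod_{i\ge1}\mathrm{Sym}(n_i)$ permutes the $e_j$ inside each interval. Let $\zeta_m\in\mathbb C$ be a primitive $m$-th root of unity and let $F\subset\mathbb C$ be a finite abelian extension of $\mathbb Q$ with $\zeta_m\in F$ (for instance $F=\mathbb Q(\zeta_m)$). Assume Hypothesis 2: the group $\boldsymbol\mu$ of roots of unity of the ring of integers of $F$ is $\langle -1\rangle\times\langle\gamma\rangle$,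 where the order $h$ of $\gamma$ is odd. Let $\Sigma$ be the set of vectors $u(e_i-\eta e_j)$ with $i\ne j$, $u\in\boldsymbol\mu$, $\eta^m=1$, together with the vectors $ue_i$ ($u\in\boldsymbol\mu$) if $p\ne m$. Let $\Phi$ be a real (Euclidean) root system of the reflection group $P_1$ that consists of elements of $\Sigma$ which are roots of reflections in $P_1$, let $\Delta$ be a set of simple roots of $\Phi$ (one may take for $\Delta$ the vectors $e_{j-1}-e_j$ with $j-1,j$ in the same interval), and put $\widetilde\Delta=\bigcup_{i=0}^{h-1}\gamma^i\Delta$. Let $e=\gcd(p,n_1,\dots,n_d)$ and $\theta=\zeta_m^{me/p}$. Let $\Delta_0$ consist of the vectors $\theta^je_1-e_2$ and $\theta^je_1-\zeta_me_2$ for $0\le j<p/e$ (omitted if $n_0=1$), the vectors $e_{i-1}-e_i$ for $3\le i\le n_0$ and, if $p\ne m$, also the vectors $\theta^je_1$ for $0\le j<p/e$ and $e_i$ for $2\le i\le n_0$. Theorem. Suppose that $m/p$ and $p/e$ are coprime and that we are not in the case $m=p=n_0=2$, $e=1$. Then $N_G(P)$ is the semidirect product of its normal subgroup $P$ by the setwise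 stabiliser of $\Delta_0\cup\widetilde\Delta$ in $G$. -/

import Mathlib

open scoped NNReal

noncomputable section

namespace ImprimitiveReflection

/-- The complex hermitian space `V` of dimension `n`, with its standard orthonormal basis. -/
abbrev V (n : ℕ) : Type := EuclideanSpace ℂ (Fin n)

/-- The orthonormal basis vector of index `i`; indices are `0, …, n - 1` in place of `1, …, n`. -/
def e {n : ℕ} (i : Fin n) : V n := EuclideanSpace.single i 1

/-- The unitary group of `V`. -/
abbrev U (n : ℕ) : Type := V n ≃ₗᵢ[ℂ] V n

/-- `imprimitiveOn m p S` is the group `G(m,p,|S|)` acting on the span of the `e i` with `i ∈ S`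
and fixing every other `e i`: its elements are the maps `e i ↦ θ i • e (σ i)`, where `σ` permutes
`S`, the values of `θ` are `m`-th roots of unity, and `(∏ i, θ i) ^ (m / p) = 1`. -/
def imprimitiveOn (m p : ℕ) {n : ℕ} (S : Set (Fin n)) : Subgroup (U n) where
  carrier := {g | ∃ (σ : Equiv.Perm (Fin n)) (θ : Fin n → ℂ),
    (∀ i, θ i ^ m = 1) ∧ (∏ i, θ i) ^ (m / p) = 1 ∧
    (∀ i, i ∉ S → σ i = i ∧ θ i = 1) ∧ ∀ i, g (e i) = θ i • e (σ i)}
  one_mem' := ⟨1, 1, by simp, by simp, by simp, by simp⟩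
  mul_mem' := by
    rintro g₁ g₂ ⟨σ₁, θ₁, hm₁, hp₁, hS₁, hg₁⟩ ⟨σ₂, θ₂, hm₂, hp₂, hS₂, hg₂⟩
    refine ⟨σ₁ * σ₂, fun i => θ₂ i * θ₁ (σ₂ i), ?_, ?_, ?_, ?_⟩
    · intro i
      simp [mul_pow, hm₁, hm₂]
    · rw [Finset.prod_mul_distrib, Equiv.prod_comp σ₂ θ₁, mul_pow, hp₁, hp₂, one_mul]
    · intro i hi
      simp [hS₂ i hi, hS₁ i hi]
    · intro i
      simp [hg₁, hg₂, smul_smul]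
  inv_mem' := by
    rintro g ⟨σ, θ, hm, hp, hS, hg⟩
    have hσ : ∀ i, i ∉ S → σ⁻¹ i = i := fun i hi => by
      rw [Equiv.Perm.inv_eq_iff_eq]; exact (hS i hi).1.symm
    refine ⟨σ⁻¹, fun i => (θ (σ⁻¹ i))⁻¹, ?_, ?_, ?_, ?_⟩
    · intro i
      simp only [inv_pow, hm, inv_one]
    · rw [Finset.prod_inv_distrib, Equiv.prod_comp σ⁻¹ θ, inv_pow, hp, inv_one]
    · intro i hi
      refine ⟨hσ i hi, ?_⟩
      simp only [hσ i hi, (hS i hi).2, inv_one]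
    · intro i
      have h0 : θ (σ⁻¹ i) ≠ 0 := by
        intro h0
        have h1 := hg (σ⁻¹ i)
        rw [h0, zero_smul, map_eq_zero_iff g g.injective] at h1
        simp [e] at h1
      have h := hg (σ⁻¹ i)
      rw [show σ (σ⁻¹ i) = i from σ.apply_symm_apply i] at h
      have h2 : g ((θ (σ⁻¹ i))⁻¹ • e (σ⁻¹ i)) = e i := by
        rw [map_smul, h, smul_smul, inv_mul_cancel₀ h0, one_smul]
      calc g⁻¹ (e i) = g⁻¹ (g ((θ (σ⁻¹ i))⁻¹ • e (σ⁻¹ i))) := by rw [h2]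
        _ = _ := g.symm_apply_apply _

/-- The imprimitive unitary reflection group `G(m,p,n)`. -/
def G (m p n : ℕ) : Subgroup (U n) := imprimitiveOn m p (Set.univ : Set (Fin n))

/-- The index set of `Λ₀ = {e₁, …, e_{n₀}}`. -/
def block₀ (n n₀ : ℕ) : Set (Fin n) := {j | j.val < n₀}

/-- The index set of the block of size `parts[i]`: the blocks are consecutive intervals that follow
the first `n₀` indices. -/
def block (n n₀ : ℕ) (parts : List ℕ) (i : ℕ) : Set (Fin n) :=
  {j | n₀ + (parts.take i).sum ≤ j.val ∧ j.val < n₀ + (parts.take (i + 1)).sum}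

/-- The factor `P₁ = ∏ᵢ G(1,1,nᵢ)`, where `G(1,1,nᵢ) ≃ Sym(nᵢ)` permutes the `i`-th block. -/
def P₁ (n n₀ : ℕ) (parts : List ℕ) : Subgroup (U n) :=
  ⨆ i : Fin parts.length, imprimitiveOn 1 1 (block n n₀ parts i)

/-- The standard parabolic subgroup `P_{(n₀,λ)} = G(m,p,n₀) × ∏ᵢ G(1,1,nᵢ)` of `G(m,p,n)`. -/
def standardParabolic (m p n n₀ : ℕ) (parts : List ℕ) : Subgroup (U n) :=
  imprimitiveOn m p (block₀ n n₀) ⊔ P₁ n n₀ parts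

/-- The reflection of order two with root `a`. -/
def rootReflection {n : ℕ} (a : V n) : U n := Submodule.reflection (Submodule.span ℂ {a})ᗮ

/-- `a` is a root of the reflection `r`. -/
def IsRootOf {n : ℕ} (a : V n) (r : U n) : Prop :=
  a ≠ 0 ∧ r ≠ 1 ∧ ∀ v ∈ (Submodule.span ℂ {a})ᗮ, r v = v

variable (F : IntermediateField ℚ ℂ)

/-- A unit of the ring of integers of `F ⊆ ℂ` as a complex number. -/
def toComplex (u : (NumberField.RingOfIntegers F)ˣ) : ℂ :=
  (((u : NumberField.RingOfIntegers F) : F) : ℂ)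

/-- The group of roots of unity of the ring of integers of `F` is `⟨-1⟩ × ⟨γ⟩`, where the order of
`γ` is odd. -/
structure Hypothesis2 (γ : (NumberField.RingOfIntegers F)ˣ) : Prop where
  odd : Odd (orderOf γ)
  disjoint : Disjoint (Subgroup.zpowers (-1 : (NumberField.RingOfIntegers F)ˣ))
    (Subgroup.zpowers γ)
  sup_eq : Subgroup.zpowers (-1 : (NumberField.RingOfIntegers F)ˣ) ⊔ Subgroup.zpowers γ =
    NumberField.Units.torsion F

/-- The root system `Σ(m,p,n)` over the ring of integers of `F` (where `F` contains the `m`-th roots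
of unity): the multiples, by roots of unity `u` of `F`, of the vectors `e i - η e j` with `i ≠ j`
and `η ^ m = 1` and, if `p ≠ m`, of the vectors `e i`. -/
def rootSystem (m p n : ℕ) : Set (V n) :=
  {a | ∃ u ∈ NumberField.Units.torsion F, ∃ η : ℂ, η ^ m = 1 ∧ ∃ i j : Fin n, i ≠ j ∧
      a = toComplex F u • (e i - η • e j)} ∪
  {a | p ≠ m ∧ ∃ u ∈ NumberField.Units.torsion F, ∃ i : Fin n, a = toComplex F u • e i}

/-- The roots in `Σ(m,p,n)` of the reflections in `P`. -/
def rootsOf (m p : ℕ) {n : ℕ} (P : Subgroup (U n)) : Set (V n) :=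
  {a | a ∈ rootSystem F m p n ∧ ∃ r ∈ P, IsRootOf a r}

/-- `Φ` is a root system, in the sense of real reflection groups, for the group `W`: a finite set of
nonzero vectors spanning a real Euclidean space, with `Φ ∩ ℝa = {a, -a}` for `a ∈ Φ`, stable under
the reflections in its elements, and these reflections generate `W`. -/
structure IsRealRootSystem {n : ℕ} (W : Subgroup (U n)) (Φ : Set (V n)) : Prop where
  finite : Φ.Finite
  zero_notMem : (0 : V n) ∉ Φ
  inner_real : ∀ a ∈ Φ, ∀ b ∈ Φ, (inner ℂ a b).im = 0
  smul_mem_iff : ∀ a ∈ Φ, ∀ c : ℝ, (c : ℂ) • a ∈ Φ ↔ c = 1 ∨ c = -1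
  image_refl : ∀ a ∈ Φ, rootReflection a '' Φ = Φ
  closure_refl : Subgroup.closure (rootReflection '' Φ) = W

/-- `Δ` is a set of simple roots in `Φ`: it is linearly independent over `ℝ`, and every element of
`Φ` is a linear combination of elements of `Δ` with real coefficients all `≥ 0` or all `≤ 0`. -/
structure IsSimpleSystem {n : ℕ} (Φ Δ : Set (V n)) : Prop where
  subset : Δ ⊆ Φ
  linearIndependent : LinearIndependent ℝ (Subtype.val : Δ → V n)
  pos_or_neg : ∀ a ∈ Φ, a ∈ Submodule.span ℝ≥0 Δ ∨ -a ∈ Submodule.span ℝ≥0 Δ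

/-- `Δ̃ = ⋃ γ^i Δ`, over `0 ≤ i < h`, where `h` is the order of `γ`. -/
def extend {n : ℕ} (γ : (NumberField.RingOfIntegers F)ˣ) (Δ : Set (V n)) : Set (V n) :=
  {v | ∃ i < orderOf γ, ∃ a ∈ Δ, v = toComplex F γ ^ i • a}

/-- `gcd(p, n₁, …, n_d)`. -/
def gcdParts (p : ℕ) (parts : List ℕ) : ℕ := parts.foldr Nat.gcd p

/-- The set `Δ₀` of roots, where `ζ` is a primitive `m`-th root of unity, `q` stands for
`gcd(p, n₁, …, n_d)` and `θ = ζ ^ (m q / p)`. It consists of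
`θ^j e₁ - e₂` and `θ^j e₁ - ζ e₂` for `0 ≤ j < p / q` (if `n₀ ≥ 2`),
`e_{i-1} - e_i` for `3 ≤ i ≤ n₀` and, if `p ≠ m`, of
`θ^j e₁` for `0 ≤ j < p / q` and `e_i` for `2 ≤ i ≤ n₀`. -/
def Δ₀ (m p n n₀ q : ℕ) (ζ : ℂ) : Set (V n) :=
  {v | ∃ a b : Fin n, a.val = 0 ∧ b.val = 1 ∧ b.val < n₀ ∧ ∃ j < p / q,
      v = (ζ ^ (m * q / p)) ^ j • e a - e b ∨ v = (ζ ^ (m * q / p)) ^ j • e a - ζ • e b} ∪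
  {v | ∃ a b : Fin n, 1 ≤ a.val ∧ b.val = a.val + 1 ∧ b.val < n₀ ∧ v = e a - e b} ∪
  {v | p ≠ m ∧ ∃ a : Fin n, a.val = 0 ∧ ∃ j < p / q, v = (ζ ^ (m * q / p)) ^ j • e a} ∪
  {v | p ≠ m ∧ ∃ b : Fin n, 1 ≤ b.val ∧ b.val < n₀ ∧ v = e b}

/-- The setwise stabiliser of a set of vectors in the unitary group. -/
def setStabilizer {n : ℕ} (S : Set (V n)) : Subgroup (U n) where
  carrier := {g | g '' S = S}
  one_mem' := by simp
  mul_mem' := by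
    intro g h hg hh
    have : (⇑(g * h) : V n → V n) = g ∘ h := rfl
    simp only [Set.mem_ofPred_eq] at hg hh ⊢
    rw [this, Set.image_comp, hh, hg]
  inv_mem' := by
    intro g hg
    simp only [Set.mem_ofPred_eq] at hg ⊢
    have : (⇑(g⁻¹) : V n → V n) = g.symm := rfl
    rw [this]
    nth_rewrite 1 [← hg]
    rw [← Set.image_comp]
    simp

/-- `N` is the (internal) semidirect product of its normal subgroup `P` by its subgroup `H`. -/
structure IsSemidirectProduct {X : Type*} [Group X] (N P H : Subgroup X) : Prop where
  left_le : P ≤ N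
  right_le : H ≤ N
  normal : (P.subgroupOf N).Normal
  complement : (P.subgroupOf N).IsComplement' (H.subgroupOf N)

end ImprimitiveReflection

end

/-!
All groups in the statement consist of monomial maps `e i ↦ θ i • e (σ i)` (`IsMonomial`), so the
theorem becomes combinatorics of a permutation `σ` and a family `θ` of roots of unity.

*The roots.* The indices fall into blocks, labelled by `IsBlockLabel` with `0` for `Λ₀`. Every
element of `Φ` is `y • (e i - e j)` with `i`, `j` in the same block and, up to interchanging `i` and
`j`, with `y` a root of unity of odd order. As inner products in `Φ` are real, `y` depends on the
block only (`exists_coefficient`); as the reflections in `Φ` generate `P₁`, every pair in a block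
occurs (`exists_smul_mem`). A linear functional equal to `1` on `Δ` then orders each block, and `Δ`
consists of the differences of consecutive basis vectors in this order. The powers of `γ` absorb the
coefficients, so that `Δ̃` depends only on the order of the blocks (`exists_rank_extend`). Thus
`Δ₀ ∪ Δ̃` is a set of vectors `α • e s + β • e t`, where `t` follows `s` in its block, and of multiples
of basis vectors of `Λ₀` (`RootDatum.roots`).

*The stabiliser lies in the normaliser.* Both an element of the normaliser of `P` and an element of
the stabiliser permute the blocks, preserve `Λ₀` when `P₀` is nontrivial, and have coefficients that
are constant on the other blocks; conversely, such maps normalise `P`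
(`RootDatum.MapsPairs.compatible`, `RootDatum.compatible_of_conj`,
`RootDatum.Compatible.isParabolic_conj`).

*The intersection is trivial.* An element of `P` in the stabiliser maps consecutive indices to
consecutive ones; on the blocks of `P₁` it keeps their order, because `-1` is not a root of unity of
odd order, and so it fixes them. On `Λ₀` the only edge that carries several roots joins the first two
indices, so the permutation is trivial there too, unless it interchanges the elements of a `Λ₀` of
size two, which happens in the excluded case only (`RootDatum.MapsPairs.apply_eq`). Then all
coefficients are `1` except possibly the first, which is a `p / q`-th root of unity, for
`q = gcd(p, n₁, …, n_d)`, and an `m / p`-th root of unity, hence `1`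
(`RootDatum.MapsPairs.eq_one`).

*The product is the normaliser.* An element of the normaliser is changed by an element of `P` as
follows: on a block of `P₁` its order is preserved or reversed, according to whether the coefficient
on the block or its negative is a power of `γ`, and on `Λ₀` it becomes `diag(t, 1, …, 1)`. The
determinant condition prescribes `t ^ (m / p)`, which is a `p / q`-th root of unity because `q`
divides the sizes of the blocks of `P₁`; as `m / p` and `p / q` are coprime, `t` may be chosen as a
`p / q`-th root of unity, and the new map stabilises the roots
(`RootDatum.Compatible.exists_mapsPairs`).
-/

namespace ImprimitiveReflection

variable {n : ℕ}

/-! ### Monomial isometries -/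

/-- `g` is the monomial map `e i ↦ θ i • e (σ i)`. -/
def IsMonomial {n : ℕ} (g : U n) (σ : Equiv.Perm (Fin n)) (θ : Fin n → ℂ) : Prop :=
  ∀ i, g (e i) = θ i • e (σ i)

lemma e_apply (i j : Fin n) : (e i : V n) j = if j = i then 1 else 0 := by
  simp [e]

lemma inner_e (i j : Fin n) : inner ℂ (e i : V n) (e j) = if i = j then (1 : ℂ) else 0 := by
  rw [e, e, EuclideanSpace.inner_single_left]
  simp

lemma sum_smul_e (v : V n) : v = ∑ i, v i • e i := by
  ext j
  simp [e_apply]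

lemma isometry_ext {g h : U n} (H : ∀ i, g (e i) = h (e i)) : g = h := by
  ext1 v
  rw [sum_smul_e v]
  simp [H]

lemma smul_e_eq {a b : ℂ} {i j : Fin n} (ha : a ≠ 0) (h : a • (e i : V n) = b • e j) :
    i = j ∧ a = b := by
  have h1 := congrArg (fun v : V n => v i) h
  simp only [PiLp.smul_apply, e_apply, smul_eq_mul] at h1
  by_cases hij : i = j
  · simp [hij] at h1
    exact ⟨hij, h1⟩
  · simp [hij] at h1
    exact absurd h1 ha

lemma IsMonomial.mul {g g' : U n} {σ σ' θ θ'} (h : IsMonomial g σ θ) (h' : IsMonomial g' σ' θ') :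
    IsMonomial (g * g') (σ * σ') (fun i => θ' i * θ (σ' i)) := by
  intro i
  simp [h' i, h (σ' i), smul_smul]

lemma IsMonomial.ne_zero {g : U n} {σ θ} (h : IsMonomial g σ θ) (i : Fin n) : θ i ≠ 0 := by
  intro h0
  have h1 := h i
  rw [h0, zero_smul, map_eq_zero_iff g g.injective] at h1
  simp [e] at h1

lemma IsMonomial.inv_apply {g : U n} {σ θ} (h : IsMonomial g σ θ) (i : Fin n) :
    g⁻¹ (e (σ i)) = (θ i)⁻¹ • e i := by
  have h2 : g ((θ i)⁻¹ • e i) = e (σ i) := by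
    rw [map_smul, h, smul_smul, inv_mul_cancel₀ (h.ne_zero i), one_smul]
  rw [← h2]
  exact g.symm_apply_apply _

lemma IsMonomial.conj_apply {g x : U n} {σ θ τ φ} (hg : IsMonomial g σ θ) (hx : IsMonomial x τ φ)
    (i : Fin n) : (g * x * g⁻¹) (e (σ i)) = ((θ i)⁻¹ * φ i * θ (τ i)) • e (σ (τ i)) := by
  change g (x (g⁻¹ (e (σ i)))) = _
  rw [hg.inv_apply, map_smul, map_smul, hx i, map_smul, hg (τ i), smul_smul, smul_smul, mul_assoc]

lemma IsMonomial.conj {g x : U n} {σ θ τ φ} (hg : IsMonomial g σ θ) (hx : IsMonomial x τ φ) :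
    IsMonomial (g * x * g⁻¹) (σ * τ * σ⁻¹)
      (fun i => (θ (σ⁻¹ i))⁻¹ * φ (σ⁻¹ i) * θ (τ (σ⁻¹ i))) := by
  intro i
  have := hg.conj_apply hx (σ⁻¹ i)
  simpa using this

lemma IsMonomial.unique {g : U n} {σ θ τ φ} (h : IsMonomial g σ θ) (h' : IsMonomial g τ φ) :
    σ = τ ∧ θ = φ := by
  have := fun i => smul_e_eq (h.ne_zero i) ((h i).symm.trans (h' i))
  exact ⟨Equiv.ext fun i => (this i).1, funext fun i => (this i).2⟩

lemma exists_isMonomial (σ : Equiv.Perm (Fin n)) (θ : Fin n → ℂ) (hθ : ∀ i, ‖θ i‖ = 1) :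
    ∃ g : U n, IsMonomial g σ θ := by
  have horth : Orthonormal ℂ (fun i => θ (σ.symm i) • (e i : V n)) := by
    rw [orthonormal_iff_ite]
    intro i j
    rw [inner_smul_left, inner_smul_right, inner_e]
    split_ifs with hij
    · subst hij
      rw [mul_one, ← Complex.normSq_eq_conj_mul_self, Complex.normSq_eq_norm_sq, hθ]
      simp
    · simp
  have hcard : Fintype.card (Fin n) = Module.finrank ℂ (V n) := by simp
  have hsp := horth.linearIndependent.span_eq_top_of_card_eq_finrank' hcard
  let b := OrthonormalBasis.mk horth hsp.ge
  refine ⟨(EuclideanSpace.basisFun (Fin n) ℂ).equiv b σ, fun i => ?_⟩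
  have := (EuclideanSpace.basisFun (Fin n) ℂ).equiv_apply_basis b σ i
  rw [EuclideanSpace.basisFun_apply] at this
  rw [e, this]
  simp [b, e]

/-! ### The blocks -/

/-- `blk` labels the elements of `Λ₀` by `0` and those of the `k`-th block, counted from `0`,
by `k + 1`. -/
structure IsBlockLabel (n n₀ : ℕ) (parts : List ℕ) (blk : Fin n → ℕ) : Prop where
  zero_iff : ∀ i, blk i = 0 ↔ i.val < n₀
  succ_iff : ∀ i k, blk i = k + 1 ↔ k < parts.length ∧ i ∈ block n n₀ parts k

lemma exists_isBlockLabel {n₀ : ℕ} {parts : List ℕ} (hsum : n = n₀ + parts.sum) :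
    ∃ blk, IsBlockLabel n n₀ parts blk := by
  have mono : ∀ a b, a ≤ b → (parts.take a).sum ≤ (parts.take b).sum := fun a b hab =>
    (List.take_sublist_take_left hab).sum_le_sum (by simp)
  have key : ∀ i : Fin n, ∃ b : ℕ, (b = 0 ↔ i.val < n₀) ∧
      ∀ k, b = k + 1 ↔ k < parts.length ∧ i ∈ block n n₀ parts k := by
    intro i
    by_cases hi : i.val < n₀
    · refine ⟨0, by simp [hi], fun k => ?_⟩
      simp only [block, Set.mem_ofPred_eq]
      omega
    · have hex : ∃ k, i.val < n₀ + (parts.take k).sum := ⟨parts.length, by simp; omega⟩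
      classical
      refine ⟨Nat.find hex, ?_, fun k => ?_⟩
      · simp [Nat.find_eq_zero, hi]
      · simp only [block, Set.mem_ofPred_eq]
        rw [Nat.find_eq_iff]
        constructor
        · rintro ⟨h1, h2⟩
          have h3 := h2 k (by omega)
          refine ⟨?_, by omega, h1⟩
          by_contra hk
          rw [List.take_of_length_le (by omega)] at h3
          omega
        · rintro ⟨h1, h2, h3⟩
          refine ⟨h3, fun j hj => ?_⟩
          have := mono j k (by omega)
          omega
  choose blk h1 h2 using key
  exact ⟨blk, h1, h2⟩

section
variable {n₀ : ℕ} {parts : List ℕ} {blk : Fin n → ℕ}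

lemma gcdParts_dvd (p : ℕ) (parts : List ℕ) :
    gcdParts p parts ∣ p ∧ ∀ k ∈ parts, gcdParts p parts ∣ k := by
  induction parts with
  | nil => simp [gcdParts]
  | cons a l ih =>
    have h : gcdParts p (a :: l) = Nat.gcd a (gcdParts p l) := rfl
    rw [h]
    refine ⟨(Nat.gcd_dvd_right _ _).trans ih.1, fun k hk => ?_⟩
    rcases List.mem_cons.1 hk with rfl | hk
    · exact Nat.gcd_dvd_left _ _
    · exact (Nat.gcd_dvd_right _ _).trans (ih.2 k hk)

lemma IsBlockLabel.gcdParts_dvd_card (hb : IsBlockLabel n n₀ parts blk)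
    (hsum : n = n₀ + parts.sum) (p : ℕ) {c : ℕ} (hc : c ≠ 0) :
    gcdParts p parts ∣ (Finset.univ.filter fun i => blk i = c).card := by
  obtain ⟨k, rfl⟩ := Nat.exists_eq_succ_of_ne_zero hc
  by_cases hk : k < parts.length
  · have h1 : (parts.take (k + 1)).sum = (parts.take k).sum + parts[k] :=
      List.sum_take_succ parts k hk
    have h2 : (parts.take (k + 1)).sum ≤ parts.sum :=
      (List.take_sublist _ _).sum_le_sum (by simp)
    have : (Finset.univ.filter fun i => blk i = k + 1).card = parts[k] := by
      rw [← Finset.card_map Fin.valEmbedding]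
      have : (Finset.univ.filter fun i => blk i = k + 1).map Fin.valEmbedding =
          Finset.Ico (n₀ + (parts.take k).sum) (n₀ + (parts.take (k + 1)).sum) := by
        ext x
        simp only [Finset.mem_map, Finset.mem_filter, Finset.mem_univ, true_and, hb.succ_iff, block,
          Set.mem_ofPred_eq, Finset.mem_Ico, Fin.valEmbedding_apply]
        constructor
        · rintro ⟨i, hi, rfl⟩
          exact hi.2
        · intro hx
          exact ⟨⟨x, by omega⟩, ⟨hk, hx⟩, rfl⟩
      rw [this, Nat.card_Ico]
      omega
    rw [Nat.succ_eq_add_one, this]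
    exact (gcdParts_dvd p parts).2 _ (List.getElem_mem hk)
  · have : (Finset.univ.filter fun i => blk i = k.succ) = ∅ := by
      ext i
      simp [hb.succ_iff, hk]
    simp [this]

/-- The permutations preserving the blocks are generated by transpositions, so a group that contains
these transpositions contains all of them. -/
lemma mem_of_forall_swap {W : Subgroup (U n)} (Z : Set (Fin n))
    (hW : ∀ i j, i ≠ j → blk i = blk j → i ∉ Z → j ∉ Z →
      ∃ g ∈ W, IsMonomial g (Equiv.swap i j) 1)
    (σ : Equiv.Perm (Fin n)) (hσ : ∀ i, blk (σ i) = blk i) (hZ : ∀ i ∈ Z, σ i = i)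
    {g : U n} (hg : IsMonomial g σ 1) : g ∈ W := by
  induction hk : σ.support.card using Nat.strong_induction_on generalizing σ g with
  | _ k ih =>
    by_cases h1 : σ = 1
    · subst h1
      have : g = 1 := isometry_ext fun i => by simp [hg i]
      exact this ▸ W.one_mem
    · obtain ⟨i, hi⟩ : ∃ i, σ i ≠ i := by
        by_contra! h
        exact h1 (Equiv.ext h)
      have hiZ : i ∉ Z := fun h => hi (hZ i h)
      have hsZ : σ i ∉ Z := fun h => hi (σ.injective (hZ _ h))
      obtain ⟨s, hs, hsm⟩ := hW i (σ i) hi.symm (hσ i).symm hiZ hsZ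
      have hlt := Equiv.Perm.card_support_swap_mul hi
      have hmon : IsMonomial (s * g) (Equiv.swap i (σ i) * σ) 1 := by
        have := hsm.mul hg
        simpa [IsMonomial] using this
      have hsw : ∀ j, blk (Equiv.swap i (σ i) j) = blk j := by
        intro j
        by_cases hj : j = i
        · subst hj
          simp [hσ]
        · by_cases hj' : j = σ i
          · subst hj'
            simp [hσ]
          · rw [Equiv.swap_apply_of_ne_of_ne hj hj']
      have := ih _ (hk ▸ hlt) (Equiv.swap i (σ i) * σ)
        (fun j => by rw [Equiv.Perm.mul_apply, hsw, hσ])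
        (fun j hj => by
          rw [Equiv.Perm.mul_apply, hZ j hj]
          exact Equiv.swap_apply_of_ne_of_ne (fun h => hiZ (h ▸ hj)) (fun h => hsZ (h ▸ hj)))
        hmon rfl
      exact (Subgroup.mul_mem_cancel_left W hs).1 this

lemma exists_swap (i j : Fin n) : ∃ g : U n, IsMonomial g (Equiv.swap i j) 1 :=
  exists_isMonomial _ _ (by simp)

lemma IsBlockLabel.mem_P₁_iff (hb : IsBlockLabel n n₀ parts blk) (g : U n) :
    g ∈ P₁ n n₀ parts ↔ ∃ σ, IsMonomial g σ 1 ∧ (∀ i, blk (σ i) = blk i) ∧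
      ∀ i, blk i = 0 → σ i = i := by
  constructor
  · intro hg
    rw [P₁] at hg
    induction hg using Subgroup.iSup_induction' with
    | hp k x hx =>
      obtain ⟨σ, θ, h1, h2, h3, h4⟩ := hx
      have hθ : θ = 1 := funext fun i => by simpa using h1 i
      subst hθ
      refine ⟨σ, h4, fun i => ?_, fun i hi => ?_⟩
      · by_cases hi : i ∈ block n n₀ parts k
        · have hs : σ i ∈ block n n₀ parts k := by
            by_contra hs
            exact hs (by rwa [σ.injective (h3 _ hs).1])
          rw [(hb.succ_iff i k).2 ⟨k.2, hi⟩, (hb.succ_iff (σ i) k).2 ⟨k.2, hs⟩]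
        · rw [(h3 i hi).1]
      · refine (h3 i fun h => ?_).1
        have := (hb.succ_iff i k).2 ⟨k.2, h⟩
        omega
    | h1 => exact ⟨1, by intro i; simp, by simp, by simp⟩
    | hmul x y hx hy ihx ihy =>
      obtain ⟨σ, h1, h2, h3⟩ := ihx
      obtain ⟨τ, k1, k2, k3⟩ := ihy
      refine ⟨σ * τ, ?_, ?_, ?_⟩
      · simpa [IsMonomial] using h1.mul k1
      · simp [h2, k2]
      · intro i hi
        simp [k3 i hi, h3 i hi]
  · rintro ⟨σ, h1, h2, h3⟩
    refine mem_of_forall_swap {i | blk i = 0} ?_ σ h2 h3 h1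
    intro i j hij hbij hi hj
    obtain ⟨g, hg⟩ := exists_swap i j
    refine ⟨g, ?_, hg⟩
    obtain ⟨k, hk⟩ := Nat.exists_eq_succ_of_ne_zero hi
    have hik := (hb.succ_iff i k).1 hk
    have hjk := (hb.succ_iff j k).1 (hbij ▸ hk)
    refine (le_iSup (fun i : Fin parts.length => imprimitiveOn 1 1 (block n n₀ parts i))
      ⟨k, hik.1⟩) ?_
    refine ⟨Equiv.swap i j, 1, by simp, by simp, fun l hl => ⟨?_, rfl⟩, hg⟩
    refine Equiv.swap_apply_of_ne_of_ne ?_ ?_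
    · rintro rfl
      exact hl hik.2
    · rintro rfl
      exact hl hjk.2

/-- The generators of the two factors are monomial maps of the stated form; conversely, a map of this
form is a block-preserving permutation matrix times a diagonal element of `P₀`. -/
lemma IsBlockLabel.mem_standardParabolic_iff (hb : IsBlockLabel n n₀ parts blk) {m p : ℕ}
    (hm : m ≠ 0) (g : U n) :
    g ∈ standardParabolic m p n n₀ parts ↔ ∃ σ θ, IsMonomial g σ θ ∧ (∀ i, θ i ^ m = 1) ∧
      (∏ i, θ i) ^ (m / p) = 1 ∧ (∀ i, blk (σ i) = blk i) ∧ ∀ i, blk i ≠ 0 → θ i = 1 := by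
  constructor
  · intro hg
    rw [standardParabolic] at hg
    refine Subgroup.closure_induction (k := (imprimitiveOn m p (block₀ n n₀) : Set (U n)) ∪
      P₁ n n₀ parts) (p := fun g _ => ∃ σ θ, IsMonomial g σ θ ∧ (∀ i, θ i ^ m = 1) ∧
      (∏ i, θ i) ^ (m / p) = 1 ∧ (∀ i, blk (σ i) = blk i) ∧ ∀ i, blk i ≠ 0 → θ i = 1)
      ?_ ?_ ?_ ?_ (by rwa [← Subgroup.sup_eq_closure])
    · rintro x (⟨σ, θ, h1, h2, h3, h4⟩ | hx)
      · refine ⟨σ, θ, h4, h1, h2, fun i => ?_, fun i hi => (h3 i ?_).2⟩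
        · by_cases hi : i ∈ block₀ n n₀
          · have hs : σ i ∈ block₀ n n₀ := by
              by_contra hs
              exact hs (by rwa [σ.injective (h3 _ hs).1])
            rw [(hb.zero_iff i).2 hi, (hb.zero_iff _).2 hs]
          · rw [(h3 i hi).1]
        · exact fun h => hi ((hb.zero_iff i).2 h)
      · obtain ⟨σ, h1, h2, h3⟩ := (hb.mem_P₁_iff x).1 hx
        exact ⟨σ, 1, h1, by simp, by simp, h2, by simp⟩
    · exact ⟨1, 1, by intro i; simp, by simp, by simp, by simp, by simp⟩
    · rintro x y - - ⟨σ, θ, h1, h2, h3, h4, h5⟩ ⟨τ, φ, k1, k2, k3, k4, k5⟩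
      refine ⟨σ * τ, _, h1.mul k1, ?_, ?_, ?_, ?_⟩
      · simp [mul_pow, h2, k2]
      · rw [Finset.prod_mul_distrib, Equiv.prod_comp τ θ, mul_pow, h3, k3, one_mul]
      · simp [h4, k4]
      · intro i hi
        rw [k5 i hi, h5 _ (by rwa [k4]), one_mul]
    · rintro x - ⟨σ, θ, h1, h2, h3, h4, h5⟩
      have hσ : ∀ i, blk (σ⁻¹ i) = blk i := fun i => by
        rw [← h4 (σ⁻¹ i)]
        simp
      refine ⟨σ⁻¹, fun i => (θ (σ⁻¹ i))⁻¹, ?_, ?_, ?_, hσ, ?_⟩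
      · intro i
        simpa using h1.inv_apply (σ⁻¹ i)
      · simp [h2]
      · rw [Finset.prod_inv_distrib, Equiv.prod_comp σ⁻¹ θ, inv_pow, h3, inv_one]
      · intro i hi
        have := h5 (σ⁻¹ i) (by rwa [hσ i])
        simp only [this, inv_one]
  · rintro ⟨σ, θ, h1, h2, h3, h4, h5⟩
    obtain ⟨s, hs⟩ := exists_isMonomial σ (1 : Fin n → ℂ) (by simp)
    have hsP : s ∈ standardParabolic m p n n₀ parts := by
      refine mem_of_forall_swap ∅ ?_ σ h4 (by simp) hs
      intro i j hij hbij _ _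
      obtain ⟨g, hg⟩ := exists_swap i j
      refine ⟨g, ?_, hg⟩
      by_cases hi : blk i = 0
      · refine (le_sup_left : imprimitiveOn m p (block₀ n n₀) ≤ _) ?_
        refine ⟨Equiv.swap i j, 1, by simp, by simp, fun l hl => ⟨?_, rfl⟩, hg⟩
        refine Equiv.swap_apply_of_ne_of_ne ?_ ?_
        · rintro rfl
          exact hl ((hb.zero_iff _).1 hi)
        · rintro rfl
          exact hl ((hb.zero_iff _).1 (hbij ▸ hi))
      · refine (le_sup_right : P₁ n n₀ parts ≤ _) ((hb.mem_P₁_iff g).2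
          ⟨Equiv.swap i j, hg, fun l => ?_, fun l hl => ?_⟩)
        · by_cases hl : l = i
          · simp [hl, hbij]
          · by_cases hl' : l = j
            · simp [hl', hbij]
            · rw [Equiv.swap_apply_of_ne_of_ne hl hl']
        · refine Equiv.swap_apply_of_ne_of_ne ?_ ?_
          · rintro rfl
            exact hi hl
          · rintro rfl
            exact hi (hbij ▸ hl)
    obtain ⟨d, hd⟩ := exists_isMonomial (1 : Equiv.Perm (Fin n)) θ
      (fun i => Complex.norm_eq_one_of_pow_eq_one (h2 i) hm)
    have hg : g = s * d := isometry_ext fun i => by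
      rw [h1 i, hs.mul hd i]
      simp
    rw [hg]
    refine mul_mem hsP ((le_sup_left : imprimitiveOn m p (block₀ n n₀) ≤ _) ?_)
    exact ⟨1, θ, h2, h3, fun i hi => ⟨rfl, h5 i fun h => hi ((hb.zero_iff i).1 h)⟩, hd⟩

end

/-! ### Roots of unity -/

section
variable {F : IntermediateField ℚ ℂ} {γ : (NumberField.RingOfIntegers F)ˣ}

lemma toComplex_pow (u : (NumberField.RingOfIntegers F)ˣ) (k : ℕ) :
    toComplex F (u ^ k) = toComplex F u ^ k := by
  simp [toComplex]

lemma toComplex_injective : Function.Injective (toComplex F) := by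
  intro u v h
  simpa [toComplex, Units.ext_iff] using h

lemma isPrimitiveRoot_toComplex : IsPrimitiveRoot (toComplex F γ) (orderOf γ) := by
  have h1 : toComplex F 1 = 1 := by simp [toComplex]
  refine ⟨?_, fun l hl => ?_⟩
  · rw [← toComplex_pow, pow_orderOf_eq_one, h1]
  · rw [← toComplex_pow, ← h1] at hl
    exact orderOf_dvd_of_pow_eq_one (toComplex_injective hl)

lemma Hypothesis2.toComplex_pow_orderOf (hyp : Hypothesis2 F γ)
    {u : (NumberField.RingOfIntegers F)ˣ} (hu : u ∈ NumberField.Units.torsion F) :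
    toComplex F u ^ orderOf γ = 1 ∨ toComplex F u ^ orderOf γ = -1 := by
  rw [← hyp.sup_eq, Subgroup.mem_sup] at hu
  obtain ⟨a, ha, b, hb, rfl⟩ := hu
  obtain ⟨k, rfl⟩ := Subgroup.mem_zpowers_iff.1 ha
  obtain ⟨l, rfl⟩ := Subgroup.mem_zpowers_iff.1 hb
  have h2 : (γ ^ l) ^ orderOf γ = 1 := by
    rw [← zpow_natCast, zpow_comm, zpow_natCast, pow_orderOf_eq_one, one_zpow]
  rw [← toComplex_pow, mul_pow, h2, mul_one]
  rcases Int.even_or_odd k with hk | hk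
  · left
    simp [hk.neg_one_zpow, toComplex]
  · right
    simp [hk.neg_one_zpow, hyp.odd.neg_one_pow, toComplex]

/-- Since `ζ ∈ F`, an `m`-th root of unity is a root of unity of `F`, that is, up to sign a power
of `γ`. -/
lemma Hypothesis2.pow_orderOf_of_pow_eq_one (hyp : Hypothesis2 F γ) {ζ η : ℂ} {m : ℕ} (hm : m ≠ 0)
    (hζ : IsPrimitiveRoot ζ m) (hζF : ζ ∈ F) (hη : η ^ m = 1) :
    η ^ orderOf γ = 1 ∨ η ^ orderOf γ = -1 := by
  have : NeZero m := ⟨hm⟩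
  obtain ⟨k, -, rfl⟩ := hζ.eq_pow_of_pow_eq_one hη
  have hmem : ζ ^ k ∈ F := pow_mem hζF k
  have hx : (⟨ζ ^ k, hmem⟩ : F) ^ m = 1 := by
    ext
    simpa using hη
  have hint : IsIntegral ℤ (⟨ζ ^ k, hmem⟩ : F) :=
    IsIntegral.of_pow (Nat.pos_of_ne_zero hm) (hx ▸ isIntegral_one)
  let y : NumberField.RingOfIntegers F := ⟨_, hint⟩
  have hy : y ^ m = 1 := by
    apply NumberField.RingOfIntegers.ext
    push_cast
    exact hx
  let u := Units.ofPowEqOne y m hy hm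
  have hu : u ∈ NumberField.Units.torsion F := by
    rw [NumberField.Units.torsion, CommGroup.mem_torsion, isOfFinOrder_iff_pow_eq_one]
    exact ⟨m, Nat.pos_of_ne_zero hm, Units.pow_ofPowEqOne hy hm⟩
  exact hyp.toComplex_pow_orderOf hu

end

lemma eq_one_of_pow_eq_one_of_im_eq_zero {h : ℕ} (hh : Odd h) {x : ℂ} (hx : x ^ h = 1)
    (him : x.im = 0) : x = 1 := by
  have h1 : x = (x.re : ℂ) := Complex.ext rfl (by simpa using him)
  rw [h1] at hx ⊢
  have h2 : x.re ^ h = 1 := by exact_mod_cast hx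
  have h3 : x.re = 1 := hh.strictMono_pow.injective (by simpa using h2)
  rw [h3, Complex.ofReal_one]

/-- Two roots of unity of the same odd order are equal when their multiples of two non-orthogonal
real vectors have a real inner product. -/
lemma eq_of_inner_im_eq_zero {h : ℕ} (hh : Odd h) {y z : ℂ} (hy : y ^ h = 1) (hz : z ^ h = 1)
    {v w : V n} {r : ℝ} (hr : r ≠ 0) (hvw : inner ℂ v w = (r : ℂ))
    (him : (inner ℂ (y • v) (z • w)).im = 0) : y = z := by
  have hn : ‖y‖ = 1 := Complex.norm_eq_one_of_pow_eq_one hy hh.pos.ne'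
  have hc : (starRingEnd ℂ) y = y⁻¹ := (Complex.inv_eq_conj hn).symm
  have hy0 : y ≠ 0 := by
    rintro rfl
    simp at hn
  rw [inner_smul_left, inner_smul_right, hvw, hc, ← mul_assoc, Complex.im_mul_ofReal] at him
  have := eq_one_of_pow_eq_one_of_im_eq_zero hh (x := y⁻¹ * z)
    (by rw [mul_pow, inv_pow, hy, hz]; simp) (by simpa [hr] using him)
  field_simp at this
  exact this.symm

lemma inner_sub_e (i j k l : Fin n) : inner ℂ (e i - e j : V n) (e k - e l) =
    (((if i = k then 1 else 0) - (if i = l then 1 else 0) - (if j = k then 1 else 0) +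
      (if j = l then 1 else 0) : ℝ) : ℂ) := by
  rw [inner_sub_left, inner_sub_right, inner_sub_right]
  simp only [inner_e]
  split_ifs <;> norm_num

/-! ### Real root systems of products of symmetric groups -/

section
variable {n₀ : ℕ} {parts : List ℕ} {blk : Fin n → ℕ}

/-- A reflection moves every vector along its roots. -/
lemma IsRootOf.sub_mem_span {a : V n} {r : U n} (h : IsRootOf a r) (v : V n) :
    r v - v ∈ Submodule.span ℂ {a} := by
  rw [← Submodule.orthogonal_orthogonal (Submodule.span ℂ {a}), Submodule.mem_orthogonal]
  intro w hw
  rw [inner_sub_right]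
  nth_rewrite 1 [← h.2.2 w hw]
  rw [r.inner_map_map, sub_self]

/-- A root in `Σ(m,p,n)` of a reflection `r ∈ P₁` is proportional to `r (e i) - e i` for every `i` that
`r` moves; a coefficient whose `h`-th power is `-1` is replaced by its negative by interchanging
the two indices. -/
lemma exists_eq_smul_of_mem_rootsOf {F : IntermediateField ℚ ℂ}
    {γ : (NumberField.RingOfIntegers F)ˣ} (hyp : Hypothesis2 F γ)
    (hb : IsBlockLabel n n₀ parts blk) {m p : ℕ} {a : V n}
    (ha : a ∈ rootsOf F m p (P₁ n n₀ parts)) :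
    ∃ (y : ℂ) (i j : Fin n), y ^ orderOf γ = 1 ∧ i ≠ j ∧ blk i = blk j ∧ blk i ≠ 0 ∧
      a = y • (e i - e j) := by
  obtain ⟨hroot, r, hr, hra⟩ := ha
  obtain ⟨σ, hσ, hσb, hσ0⟩ := (hb.mem_P₁_iff r).1 hr
  obtain ⟨i, hi⟩ : ∃ i, σ i ≠ i := by
    by_contra! h
    exact hra.2.1 (isometry_ext fun i => by simp [hσ i, h i])
  have hi0 : blk i ≠ 0 := fun h => hi (hσ0 i h)
  obtain ⟨t, ht⟩ := Submodule.mem_span_singleton.1 (hra.sub_mem_span (e i))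
  rw [hσ i] at ht
  have e1 := congrArg (fun v : V n => v (σ i)) ht
  have e2 := congrArg (fun v : V n => v i) ht
  simp only [PiLp.smul_apply, PiLp.sub_apply, e_apply, smul_eq_mul, Pi.one_apply, one_smul,
    if_true, hi, hi.symm, if_false, sub_zero, zero_sub] at e1 e2
  have fin : ∀ (u : ℂ) (k l : Fin n), (u ^ orderOf γ = 1 ∨ u ^ orderOf γ = -1) → k ≠ l →
      blk k = blk l → blk k ≠ 0 → a = u • (e k - e l) →
      ∃ (y : ℂ) (i j : Fin n), y ^ orderOf γ = 1 ∧ i ≠ j ∧ blk i = blk j ∧ blk i ≠ 0 ∧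
      a = y • (e i - e j) := by
    intro u k l hu hkl hbl hk ha
    rcases hu with hu | hu
    · exact ⟨u, k, l, hu, hkl, hbl, hk, ha⟩
    · refine ⟨-u, l, k, ?_, hkl.symm, hbl.symm, hbl ▸ hk, ?_⟩
      · rw [hyp.odd.neg_pow, hu, neg_neg]
      · rw [ha, neg_smul, ← smul_neg, neg_sub]
  rcases hroot with ⟨u, hu, η, -, k, l, hkl, rfl⟩ | ⟨-, u, hu, k, rfl⟩
  · simp only [PiLp.smul_apply, PiLp.sub_apply, e_apply, smul_eq_mul] at e1 e2
    by_cases h1 : σ i = k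
    · have hik : i ≠ k := fun h => hi (h1.trans h.symm)
      by_cases h2 : i = l
      · subst h2
        simp only [h1, hkl, hkl.symm, if_true, if_false] at e1 e2
        have hη : η = 1 := by
          have : t * (toComplex F u * (1 - η * 0)) = 1 := by simpa using e1
          linear_combination (-η) * this - e2
        subst hη
        refine fin (toComplex F u) k i (hyp.toComplex_pow_orderOf hu) hkl ?_ ?_ (by simp)
        · rw [← h1, hσb]
        · rwa [← h1, hσb]
      · simp [hik, h2] at e2
    · by_cases h3 : σ i = l
      · by_cases h4 : i = k
        · subst h4
          simp only [h3, hkl, hkl.symm, if_true, if_false] at e1 e2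
          have hη : η = 1 := by
            linear_combination η * e2 + e1
          subst hη
          refine fin (toComplex F u) i l (hyp.toComplex_pow_orderOf hu) hkl ?_ ?_ (by simp)
          · rw [← h3, hσb]
          · exact hi0
        · have h5 : i ≠ l := fun h => hi (h3.trans h.symm)
          simp [h4, h5] at e2
      · simp [h1, h3] at e1
  · simp only [PiLp.smul_apply, e_apply, smul_eq_mul] at e1 e2
    by_cases h1 : σ i = k
    · have hik : i ≠ k := fun h => hi (h1.trans h.symm)
      simp [hik] at e2
    · simp [h1] at e1

lemma rootReflection_apply (a v : V n) :
    rootReflection a v = v - (2 * (inner ℂ a v / inner ℂ a a)) • a := by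
  rw [rootReflection, Submodule.reflection_orthogonal_apply, Submodule.reflection_singleton_apply,
    inner_self_eq_norm_sq_to_K]
  simp only [neg_sub, two_smul, two_mul, add_smul]

lemma rootReflection_smul_apply {y : ℂ} (hy : ‖y‖ = 1) {i j : Fin n} (hij : i ≠ j) (v : V n) :
    rootReflection (y • (e i - e j)) v = v - (v i - v j) • (e i - e j) := by
  have hy0 : y ≠ 0 := by
    rintro rfl
    simp at hy
  have hcy : (starRingEnd ℂ) y ≠ 0 := by simpa using hy0
  have h1 : inner ℂ (e i - e j : V n) v = v i - v j := by
    simp [e, EuclideanSpace.inner_single_left]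
  have h2 : inner ℂ (e i - e j : V n) (e i - e j) = 2 := by
    rw [inner_sub_e]
    simp [hij, hij.symm]
    norm_num
  rw [rootReflection_apply, smul_smul]
  simp only [inner_smul_left, inner_smul_right, h1, h2]
  congr 2
  field_simp

lemma rootReflection_e {y : ℂ} (hy : ‖y‖ = 1) {i j : Fin n} (hij : i ≠ j) (k : Fin n) :
    rootReflection (y • (e i - e j)) (e k) = e (Equiv.swap i j k) := by
  rw [rootReflection_smul_apply hy hij]
  simp only [e_apply]
  by_cases h1 : k = i
  · subst h1
    simp [hij.symm]
  · by_cases h2 : k = j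
    · subst h2
      simp [hij]
    · rw [Equiv.swap_apply_of_ne_of_ne h1 h2]
      simp [Ne.symm h1, Ne.symm h2]

/-- Since `Φ` is a root system for `P₁`, every transposition in `P₁` has a root in `Φ`: the pairs
that belong to roots in `Φ` form an equivalence relation, which every element of `P₁` respects. -/
lemma exists_smul_mem {h : ℕ} (hh : Odd h) (hb : IsBlockLabel n n₀ parts blk) {Φ : Set (V n)}
    (hΦ : IsRealRootSystem (P₁ n n₀ parts) Φ)
    (hform : ∀ a ∈ Φ, ∃ (y : ℂ) (i j : Fin n), y ^ h = 1 ∧ i ≠ j ∧ blk i = blk j ∧ blk i ≠ 0 ∧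
      a = y • (e i - e j)) {i j : Fin n} (hij : i ≠ j) (hbij : blk i = blk j) (hi : blk i ≠ 0) :
    ∃ y : ℂ, y ^ h = 1 ∧ y • (e i - e j) ∈ Φ := by
  have norm_one : ∀ y : ℂ, y ^ h = 1 → ‖y‖ = 1 := fun y hy =>
    Complex.norm_eq_one_of_pow_eq_one hy hh.pos.ne'
  let R : Fin n → Fin n → Prop := fun i j => i = j ∨ ∃ y : ℂ, y ^ h = 1 ∧ y • (e i - e j) ∈ Φ
  have symm : ∀ i j, R i j → R j i := by
    rintro i j (rfl | ⟨y, hy, hmem⟩)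
    · exact Or.inl rfl
    · refine Or.inr ⟨y, hy, ?_⟩
      have := (hΦ.smul_mem_iff _ hmem (-1)).2 (Or.inr rfl)
      simpa [← smul_neg] using this
  have trans : ∀ i j k, R i j → R j k → R i k := by
    rintro i j k (rfl | ⟨y, hy, hmem⟩) (rfl | ⟨z, hz, hmem'⟩)
    · exact Or.inl rfl
    · exact Or.inr ⟨z, hz, hmem'⟩
    · exact Or.inr ⟨y, hy, hmem⟩
    · by_cases hik : i = k
      · exact Or.inl hik
      have hij : i ≠ j := by
        rintro rfl
        exact hΦ.zero_notMem (by simpa using hmem)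
      have hjk : j ≠ k := by
        rintro rfl
        exact hΦ.zero_notMem (by simpa using hmem')
      have hyz : y = z := eq_of_inner_im_eq_zero hh hy hz (r := -1) (by norm_num)
        (by rw [inner_sub_e]; simp [hij, hjk, hik]) (hΦ.inner_real _ hmem _ hmem')
      subst hyz
      refine Or.inr ⟨y, hy, ?_⟩
      rw [← hΦ.image_refl _ hmem]
      refine ⟨_, hmem', ?_⟩
      rw [map_smul, map_sub, rootReflection_e (norm_one y hy) hij,
        rootReflection_e (norm_one y hy) hij, Equiv.swap_apply_right,
        Equiv.swap_apply_of_ne_of_ne (Ne.symm hik) hjk.symm]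
  have key : ∀ g ∈ P₁ n n₀ parts, ∀ k, ∃ l, g (e k) = e l ∧ R k l := by
    intro g hg
    rw [← hΦ.closure_refl] at hg
    have gen : ∀ x ∈ rootReflection '' Φ, ∀ k, ∃ l, x (e k) = e l ∧ R k l := by
      rintro _ ⟨a, ha, rfl⟩ k
      obtain ⟨y, i, j, hy, hij, -, -, rfl⟩ := hform a ha
      refine ⟨_, rootReflection_e (norm_one y hy) hij k, ?_⟩
      by_cases h1 : k = i
      · subst h1
        rw [Equiv.swap_apply_left]
        exact Or.inr ⟨y, hy, ha⟩
      · by_cases h2 : k = j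
        · subst h2
          rw [Equiv.swap_apply_right]
          exact symm _ _ (Or.inr ⟨y, hy, ha⟩)
        · rw [Equiv.swap_apply_of_ne_of_ne h1 h2]
          exact Or.inl rfl
    induction hg using Subgroup.closure_induction_left with
    | one => exact fun k => ⟨k, rfl, Or.inl rfl⟩
    | mul_left x hx y hy ih =>
      intro k
      obtain ⟨l, hl, hkl⟩ := ih k
      obtain ⟨l', hl', hll'⟩ := gen x hx l
      refine ⟨l', ?_, trans _ _ _ hkl hll'⟩
      change x (y (e k)) = _
      rw [hl, hl']
    | inv_mul_cancel x hx y hy ih =>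
      intro k
      obtain ⟨l, hl, hkl⟩ := ih k
      obtain ⟨l', hl', hll'⟩ := gen x hx l
      refine ⟨l', ?_, trans _ _ _ hkl hll'⟩
      change x⁻¹ (y (e k)) = _
      have hxx : x⁻¹ = x := by
        obtain ⟨a, -, rfl⟩ := hx
        exact Submodule.reflection_inv
      rw [hl, hxx, hl']
  obtain ⟨s, hs⟩ := exists_swap i j
  have hsP : s ∈ P₁ n n₀ parts := by
    refine (hb.mem_P₁_iff s).2 ⟨_, hs, fun l => ?_, fun l hl => ?_⟩
    · by_cases hl : l = i
      · simp [hl, hbij]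
      · by_cases hl' : l = j
        · simp [hl', hbij]
        · rw [Equiv.swap_apply_of_ne_of_ne hl hl']
    · refine Equiv.swap_apply_of_ne_of_ne ?_ ?_
      · rintro rfl
        exact hi hl
      · rintro rfl
        exact hi (hbij ▸ hl)
  obtain ⟨l, hl, hR⟩ := key s hsP i
  have := hs i
  rw [hl, Equiv.swap_apply_left] at this
  obtain rfl : l = j := (smul_e_eq (a := 1) (b := 1) one_ne_zero (by simpa using this)).1
  exact hR.resolve_left hij

/-- The coefficients of the roots in `Φ` are constant on each block. -/
lemma exists_coefficient {h : ℕ} (hh : Odd h) (hb : IsBlockLabel n n₀ parts blk) {Φ : Set (V n)}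
    (hΦ : IsRealRootSystem (P₁ n n₀ parts) Φ)
    (hform : ∀ a ∈ Φ, ∃ (y : ℂ) (i j : Fin n), y ^ h = 1 ∧ i ≠ j ∧ blk i = blk j ∧ blk i ≠ 0 ∧
      a = y • (e i - e j)) :
    ∃ x : Fin n → ℂ, (∀ i, x i ^ h = 1) ∧
      (∀ i j, i ≠ j → blk i = blk j → blk i ≠ 0 → x i = x j ∧ x i • (e i - e j) ∈ Φ) ∧
      ∀ a ∈ Φ, ∃ i j, i ≠ j ∧ blk i = blk j ∧ blk i ≠ 0 ∧ a = x i • (e i - e j) := by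
  have key : ∀ i, ∃ y : ℂ, y ^ h = 1 ∧ ∀ j, i ≠ j → blk i = blk j → blk i ≠ 0 →
      y • (e i - e j) ∈ Φ := by
    intro i
    by_cases hex : ∃ j, i ≠ j ∧ blk i = blk j ∧ blk i ≠ 0
    · obtain ⟨j, hij, hbij, hi⟩ := hex
      obtain ⟨y, hy, hmem⟩ := exists_smul_mem hh hb hΦ hform hij hbij hi
      refine ⟨y, hy, fun k hik hbik _ => ?_⟩
      obtain ⟨z, hz, hmem'⟩ := exists_smul_mem hh hb hΦ hform hik hbik hi
      have : y = z := eq_of_inner_im_eq_zero hh hy hz (r := 1 + if j = k then 1 else 0)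
        (by split_ifs <;> norm_num) (by rw [inner_sub_e]; simp [hij.symm, hik])
        (hΦ.inner_real _ hmem _ hmem')
      rwa [this]
    · exact ⟨1, one_pow h, fun j h1 h2 h3 => absurd ⟨j, h1, h2, h3⟩ hex⟩
  choose x hx hmem using key
  refine ⟨x, hx, fun i j hij hbij hi => ⟨?_, hmem i j hij hbij hi⟩, fun a ha => ?_⟩
  · exact eq_of_inner_im_eq_zero hh (hx i) (hx j) (r := -2) (by norm_num)
      (by rw [inner_sub_e]; simp [hij, hij.symm]; norm_num)
      (hΦ.inner_real _ (hmem i j hij hbij hi) _ (hmem j i hij.symm hbij.symm (hbij ▸ hi)))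
  · obtain ⟨y, i, j, hy, hij, hbij, hi, rfl⟩ := hform a ha
    refine ⟨i, j, hij, hbij, hi, ?_⟩
    rw [eq_of_inner_im_eq_zero hh hy (hx i) (r := 2) (by norm_num)
      (by rw [inner_sub_e]; simp [hij, hij.symm]; norm_num)
      (hΦ.inner_real _ ha _ (hmem i j hij hbij hi))]

lemma exists_functional {Δ : Set (V n)} (hΔ : LinearIndependent ℝ (Subtype.val : Δ → V n))
    (w : V n → ℝ) : ∃ f : V n →ₗ[ℝ] ℝ, ∀ δ ∈ Δ, f δ = w δ := by
  obtain ⟨f, hf⟩ := LinearMap.exists_extend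
    ((Module.Basis.span hΔ).constr ℝ (fun δ : Δ => w δ))
  refine ⟨f, fun δ hδ => ?_⟩
  have h1 := (Module.Basis.span hΔ).constr_basis ℝ (fun δ : Δ => w δ) ⟨δ, hδ⟩
  rw [← hf, LinearMap.comp_apply, Module.Basis.span_apply] at h1
  exact h1

/-- A functional that is nonnegative on a set is nonnegative on the cone spanned by it, and its
zeros on the cone lie on the face spanned by its zeros on the set. -/
lemma nonneg_of_mem_span {Δ : Set (V n)} {f : V n →ₗ[ℝ] ℝ} (hf : ∀ δ ∈ Δ, 0 ≤ f δ) {v : V n}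
    (hv : v ∈ Submodule.span ℝ≥0 Δ) :
    0 ≤ f v ∧ (f v = 0 → v ∈ Submodule.span ℝ {δ ∈ Δ | f δ = 0}) := by
  induction hv using Submodule.span_induction with
  | mem x hx => exact ⟨hf x hx, fun h => Submodule.subset_span ⟨hx, h⟩⟩
  | zero => simp
  | add x y _ _ hx hy =>
    rw [map_add]
    refine ⟨add_nonneg hx.1 hy.1, fun h => ?_⟩
    exact add_mem (hx.2 (by linarith [hx.1, hy.1])) (hy.2 (by linarith [hx.1, hy.1]))
  | smul c x _ hx =>
    rw [NNReal.smul_def, map_smul, smul_eq_mul]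
    refine ⟨mul_nonneg c.2 hx.1, fun h => ?_⟩
    rcases mul_eq_zero.1 h with h | h
    · simp [h]
    · exact Submodule.smul_mem _ _ (hx.2 h)

/-- Elements of a linearly independent set are indecomposable in the cone spanned by it. -/
lemma mem_span_singleton_of_add_mem {Δ : Set (V n)}
    (hΔ : LinearIndependent ℝ (Subtype.val : Δ → V n)) {a b : V n}
    (ha : a ∈ Submodule.span ℝ≥0 Δ) (hb : b ∈ Submodule.span ℝ≥0 Δ) (hab : a + b ∈ Δ) :
    a ∈ Submodule.span ℝ {a + b} := by
  classical
  obtain ⟨f, hf⟩ := exists_functional hΔ (fun v => if v = a + b then 0 else 1)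
  have hf0 : ∀ δ ∈ Δ, 0 ≤ f δ := fun δ hδ => by
    rw [hf δ hδ]
    split_ifs <;> norm_num
  have h1 := nonneg_of_mem_span hf0 ha
  have h2 := nonneg_of_mem_span hf0 hb
  have h3 := hf _ hab
  rw [if_pos rfl, map_add] at h3
  refine Submodule.span_mono ?_ (h1.2 (by linarith [h1.1, h2.1]))
  rintro δ ⟨hδ, h0⟩
  rw [hf δ hδ] at h0
  refine Set.mem_singleton_iff.2 (by_contra fun hne => ?_)
  rw [if_neg hne] at h0
  exact one_ne_zero h0

/-! ### The rank of an index in its block -/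

/-- `ρ` counts the positions in each block from `0`; in the block with label `0` these are the
indices themselves. -/
structure IsRank (blk ρ : Fin n → ℕ) : Prop where
  val : ∀ i, blk i = 0 → ρ i = i.val
  inj : ∀ i j, blk i = blk j → ρ i = ρ j → i = j
  lt_card_iff : ∀ i k, k < (Finset.univ.filter fun j => blk j = blk i).card ↔
    ∃ j, blk j = blk i ∧ ρ j = k

/-- A real function that is injective on blocks ranks each block by decreasing values. -/
lemma exists_isRank (blk : Fin n → ℕ) (f : Fin n → ℝ)
    (hf : ∀ i j, blk i = blk j → f i = f j → i = j)
    (hf0 : ∀ i, blk i = 0 → f i = -(i.val : ℝ))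
    (hblk : ∀ i j : Fin n, blk i = 0 → j < i → blk j = 0) :
    ∃ ρ, IsRank blk ρ ∧ ∀ i j, blk i = blk j → (ρ i < ρ j ↔ f j < f i) := by
  classical
  let S : Fin n → Finset (Fin n) := fun i => Finset.univ.filter fun j => blk j = blk i ∧ f i < f j
  let ρ : Fin n → ℕ := fun i => (S i).card
  have hlt : ∀ i j, blk i = blk j → f j < f i → ρ i < ρ j := by
    intro i j hij h
    refine Finset.card_lt_card ⟨fun k hk => ?_, fun hs => ?_⟩
    · simp only [S, Finset.mem_filter, Finset.mem_univ, true_and] at hk ⊢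
      exact ⟨hk.1.trans hij, h.trans hk.2⟩
    · have : i ∈ S i := hs (by simp [S, hij, h])
      simp [S] at this
  have hiff : ∀ i j, blk i = blk j → (ρ i < ρ j ↔ f j < f i) := by
    intro i j hij
    refine ⟨fun h => ?_, hlt i j hij⟩
    by_contra hn
    rcases (not_lt.1 hn).eq_or_lt with h' | h'
    · rw [hf i j hij h'] at h
      exact lt_irrefl _ h
    · exact lt_asymm h (hlt j i hij.symm h')
  have hinj : ∀ i j, blk i = blk j → ρ i = ρ j → i = j := by
    intro i j hij h
    refine hf i j hij (le_antisymm ?_ ?_) <;> by_contra hn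
    · exact (hlt i j hij (not_le.1 hn)).ne h
    · exact (hlt j i hij.symm (not_le.1 hn)).ne' h
  refine ⟨ρ, ⟨fun i hi => ?_, hinj, fun i k => ?_⟩, hiff⟩
  · have : S i = Finset.Iio i := by
      ext j
      simp only [S, Finset.mem_filter, Finset.mem_univ, true_and, Finset.mem_Iio]
      constructor
      · rintro ⟨h1, h2⟩
        rw [hf0 i hi, hf0 j (h1.trans hi), neg_lt_neg_iff] at h2
        exact_mod_cast h2
      · intro h
        have hj := hblk i j hi h
        refine ⟨hj.trans hi.symm, ?_⟩
        rw [hf0 i hi, hf0 j hj, neg_lt_neg_iff]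
        exact_mod_cast h
    change (S i).card = _
    rw [this, Fin.card_Iio]
  · have himg : (Finset.univ.filter fun j => blk j = blk i).image ρ =
        Finset.range (Finset.univ.filter fun j => blk j = blk i).card := by
      refine Finset.eq_of_subset_of_card_le (fun k hk => ?_) ?_
      · obtain ⟨j, hj, rfl⟩ := Finset.mem_image.1 hk
        simp only [Finset.mem_filter, Finset.mem_univ, true_and] at hj
        refine Finset.mem_range.2 (Finset.card_lt_card ⟨fun l hl => ?_, fun hs => ?_⟩)
        · simp only [S, Finset.mem_filter, Finset.mem_univ, true_and] at hl ⊢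
          exact hl.1.trans hj
        · have : j ∈ S j := hs (by simp [hj])
          simp [S] at this
      · rw [Finset.card_range, Finset.card_image_of_injOn]
        intro j hj l hl h
        simp only [Finset.coe_filter, Finset.mem_univ, true_and, Set.mem_ofPred_eq] at hj hl
        exact hinj j l (hj.trans hl.symm) h
    rw [← Finset.mem_range, ← himg]
    simp

/-- The extended simple system consists of the multiples, by roots of unity of odd order, of the
differences of consecutive basis vectors, for some ordering of each block. -/
lemma exists_rank_extend {F : IntermediateField ℚ ℂ}
    {γ : (NumberField.RingOfIntegers F)ˣ} (hyp : Hypothesis2 F γ)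
    (hb : IsBlockLabel n n₀ parts blk) {m p : ℕ} {Φ Δ : Set (V n)}
    (hΦ : IsRealRootSystem (P₁ n n₀ parts) Φ) (hyp1 : Φ ⊆ rootsOf F m p (P₁ n n₀ parts))
    (hΔ : IsSimpleSystem Φ Δ) :
    ∃ ρ, IsRank blk ρ ∧ extend F γ Δ = {v | ∃ (i j : Fin n) (y : ℂ), blk i = blk j ∧ blk i ≠ 0 ∧
      ρ j = ρ i + 1 ∧ y ^ orderOf γ = 1 ∧ v = y • (e i - e j)} := by
  classical
  have hodd := hyp.odd
  obtain ⟨x, hx1, hxΦ, hΦx⟩ := exists_coefficient hodd hb hΦ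
    (fun a ha => exists_eq_smul_of_mem_rootsOf hyp hb (hyp1 ha))
  have hx0 : ∀ i, x i ≠ 0 := fun i h0 => by
    have := hx1 i
    rw [h0, zero_pow hodd.pos.ne'] at this
    exact zero_ne_one this
  obtain ⟨f, hf⟩ := exists_functional hΔ.linearIndependent (fun _ => 1)
  have hfpos : ∀ a ∈ Submodule.span ℝ≥0 Δ, a ∈ Φ → 0 < f a := by
    intro a ha haΦ
    have h1 := nonneg_of_mem_span (f := f) (fun δ hδ => by rw [hf δ hδ]; exact zero_le_one) ha
    refine lt_of_le_of_ne h1.1 fun h0 => ?_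
    have h2 := h1.2 h0.symm
    have h3 : {δ ∈ Δ | f δ = 0} = ∅ := by
      ext δ
      simp only [Set.mem_ofPred_eq, Set.mem_empty_iff_false, iff_false, not_and]
      intro hδ
      rw [hf δ hδ]
      exact one_ne_zero
    rw [h3, Submodule.span_empty, Submodule.mem_bot] at h2
    exact hΦ.zero_notMem (h2 ▸ haΦ)
  have hfne : ∀ a ∈ Φ, f a ≠ 0 := by
    intro a ha h0
    rcases hΔ.pos_or_neg a ha with h | h
    · exact (hfpos a h ha).ne' h0
    · have hna : -a ∈ Φ := by
        have := (hΦ.smul_mem_iff a ha (-1)).2 (Or.inr rfl)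
        simpa using this
      have := hfpos _ h hna
      rw [map_neg, h0, neg_zero] at this
      exact lt_irrefl _ this
  have hspan : ∀ a ∈ Φ, 0 < f a → a ∈ Submodule.span ℝ≥0 Δ := by
    intro a ha h0
    refine (hΔ.pos_or_neg a ha).resolve_right fun h => ?_
    have hna : -a ∈ Φ := by
      have := (hΦ.smul_mem_iff a ha (-1)).2 (Or.inr rfl)
      simpa using this
    have := hfpos _ h hna
    rw [map_neg] at this
    linarith
  let g : Fin n → ℝ := fun i => if blk i = 0 then -(i.val : ℝ) else f (x i • e i)
  have hg : ∀ i j, i ≠ j → blk i = blk j → blk i ≠ 0 → f (x i • (e i - e j)) = g i - g j := by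
    intro i j hij hbij hi
    simp only [g, if_neg hi, if_neg (hbij ▸ hi : blk j ≠ 0)]
    rw [smul_sub, map_sub]
    nth_rewrite 2 [(hxΦ i j hij hbij hi).1]
    rfl
  obtain ⟨ρ, hρ, hρlt⟩ := exists_isRank blk g
    (fun i j hbij h => by
      by_contra hij
      by_cases hi : blk i = 0
      · simp only [g, if_pos hi, if_pos (hbij ▸ hi : blk j = 0), neg_inj, Nat.cast_inj] at h
        exact hij (Fin.ext h)
      · exact hfne _ (hxΦ i j hij hbij hi).2 (by rw [hg i j hij hbij hi, h, sub_self]))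
    (fun i hi => by simp [g, hi])
    (fun i j hi hji => by
      rw [hb.zero_iff] at hi ⊢
      exact lt_trans hji hi)
  refine ⟨ρ, hρ, ?_⟩
  -- a simple root joins consecutive indices, since it is indecomposable
  have hΔsub : ∀ a ∈ Δ, ∃ i j, blk i = blk j ∧ blk i ≠ 0 ∧ ρ j = ρ i + 1 ∧
      a = x i • (e i - e j) := by
    intro a ha
    obtain ⟨i, j, hij, hbij, hi, rfl⟩ := hΦx a (hΔ.subset ha)
    refine ⟨i, j, hbij, hi, ?_, rfl⟩
    have hlt : ρ i < ρ j := by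
      rw [hρlt i j hbij, ← sub_pos, ← hg i j hij hbij hi, hf _ ha]
      exact one_pos
    by_contra hne
    obtain ⟨k, hk, hρk⟩ := (hρ.lt_card_iff j (ρ i + 1)).1
      (lt_of_le_of_lt hlt ((hρ.lt_card_iff j (ρ j)).2 ⟨j, rfl, rfl⟩))
    have hik : i ≠ k := by
      rintro rfl
      omega
    have hkj : k ≠ j := by
      rintro rfl
      omega
    have hbik : blk i = blk k := hbij.trans hk.symm
    have hk0 : blk k ≠ 0 := hbik ▸ hi
    obtain ⟨hxik, h1⟩ := hxΦ i k hik hbik hi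
    obtain ⟨-, h2⟩ := hxΦ k j hkj hk hk0
    have hsum : x i • (e i - e k) + x k • (e k - e j) = (x i • (e i - e j) : V n) := by
      rw [← hxik, ← smul_add, sub_add_sub_cancel]
    have h3 := mem_span_singleton_of_add_mem hΔ.linearIndependent
      (hspan _ h1 (by
        rw [hg i k hik hbik hi, sub_pos, ← hρlt i k hbik]
        omega))
      (hspan _ h2 (by
        rw [hg k j hkj hk hk0, sub_pos, ← hρlt k j hk]
        omega)) (hsum ▸ ha)
    rw [hsum] at h3
    obtain ⟨c, hc⟩ := Submodule.mem_span_singleton.1 h3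
    have := congrArg (fun v : V n => v k) hc
    simp [e_apply, hik.symm, hkj, hx0 i] at this
  have hΔmem : ∀ i j, blk i = blk j → blk i ≠ 0 → ρ j = ρ i + 1 → x i • (e i - e j) ∈ Δ := by
    intro i j hbij hi hρij
    have hij : i ≠ j := by
      rintro rfl
      omega
    have hmem := (hxΦ i j hij hbij hi).2
    have hcone := hspan _ hmem (by
      rw [hg i j hij hbij hi, sub_pos, ← hρlt i j hbij]
      omega)
    -- the sum of the coordinates in the initial segment of the block that ends with `i`
    let T := Finset.univ.filter fun l => blk l = blk i ∧ ρ l ≤ ρ i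
    have hT : ∀ v ∈ Submodule.span ℝ≥0 Δ, (∀ δ ∈ Δ, ∑ l ∈ T, δ l = 0) → ∑ l ∈ T, v l = 0 := by
      intro v hv h0
      induction hv using Submodule.span_induction with
      | mem y hy => exact h0 y hy
      | zero => simp
      | add y z _ _ hy hz => simp [Finset.sum_add_distrib, hy, hz]
      | smul c y _ hy => simp [← Finset.smul_sum, hy]
    have hval : ∀ s t : Fin n, ∑ l ∈ T, (x s • (e s - e t) : V n) l =
        x s * ((if s ∈ T then 1 else 0) - (if t ∈ T then 1 else 0)) := by
      intro s t
      simp [e_apply, ← Finset.mul_sum]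
    have hiT : i ∈ T := by simp [T]
    have hjT : j ∉ T := by simp [T, hρij]
    have hne : ∃ δ ∈ Δ, ∑ l ∈ T, δ l ≠ 0 := by
      by_contra! hall
      have := hT _ hcone hall
      rw [hval, if_pos hiT, if_neg hjT] at this
      simp [hx0 i] at this
    obtain ⟨δ, hδ, hδT⟩ := hne
    obtain ⟨s, t, hst, hs, hρst, rfl⟩ := hΔsub δ hδ
    rw [hval] at hδT
    have hsT : s ∈ T := by
      by_contra h
      have ht : t ∉ T := by
        simp only [T, Finset.mem_filter, Finset.mem_univ, true_and] at h ⊢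
        rintro ⟨h1, h2⟩
        exact h ⟨hst.trans h1, by omega⟩
      simp [h, ht] at hδT
    have htT : t ∉ T := by
      intro h
      simp [hsT, h] at hδT
    simp only [T, Finset.mem_filter, Finset.mem_univ, true_and, not_and] at hsT htT
    have h1 := htT (hst ▸ hsT.1)
    obtain rfl := hρ.inj s i hsT.1 (by omega)
    obtain rfl := hρ.inj t j (hst.symm.trans hbij) (by omega)
    exact hδ
  have hprim := isPrimitiveRoot_toComplex (γ := γ)
  have : NeZero (orderOf γ) := ⟨hodd.pos.ne'⟩
  ext v
  constructor
  · rintro ⟨k, -, a, ha, rfl⟩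
    obtain ⟨i, j, h1, h2, h3, rfl⟩ := hΔsub a ha
    refine ⟨i, j, toComplex F γ ^ k * x i, h1, h2, h3, ?_, by rw [smul_smul]⟩
    rw [mul_pow, hx1, ← pow_mul, mul_comm k, pow_mul, hprim.pow_eq_one, one_pow, one_mul]
  · rintro ⟨i, j, y, h1, h2, h3, hy, rfl⟩
    obtain ⟨k, hk, hky⟩ := hprim.eq_pow_of_pow_eq_one (ξ := y * (x i)⁻¹)
      (by rw [mul_pow, inv_pow, hy, hx1, inv_one, one_mul])
    refine ⟨k, hk, _, hΔmem i j h1 h2 h3, ?_⟩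
    rw [smul_smul, hky, inv_mul_cancel_right₀ (hx0 i)]

end

/-! ### The set of roots in terms of blocks and ranks -/

lemma perm_inv_apply_apply (σ : Equiv.Perm (Fin n)) (i : Fin n) : σ⁻¹ (σ i) = i :=
  σ.symm_apply_apply i

lemma pair_eq_pair {s t s' t' : Fin n} {α β α' β' : ℂ} (hst : s ≠ t) (hst' : s' ≠ t')
    (hα : α ≠ 0) (hβ : β ≠ 0)
    (h : α • e s + β • e t = (α' • e s' + β' • e t' : V n)) :
    (s = s' ∧ t = t' ∧ α = α' ∧ β = β') ∨ (s = t' ∧ t = s' ∧ α = β' ∧ β = α') := by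
  have h1 := congrArg (fun v : V n => v s) h
  have h2 := congrArg (fun v : V n => v t) h
  simp only [PiLp.smul_apply, PiLp.add_apply, e_apply, smul_eq_mul, if_true, hst, hst.symm,
    if_false, mul_one, mul_zero, add_zero, zero_add] at h1 h2
  by_cases h3 : s = s'
  · subst h3
    by_cases h4 : t = t'
    · subst h4
      simp [hst, hst.symm] at h1 h2
      exact Or.inl ⟨rfl, rfl, h1, h2⟩
    · simp [h4, hst.symm] at h2
      exact absurd h2 hβ
  · by_cases h4 : s = t'
    · subst h4
      by_cases h5 : t = s'
      · subst h5
        simp [hst, hst.symm] at h1 h2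
        exact Or.inr ⟨rfl, rfl, h1, h2⟩
      · simp [h5, hst.symm] at h2
        exact absurd h2 hβ
    · simp [h3, h4] at h1
      exact absurd h1 hα

lemma pair_ne_single {s t s' : Fin n} {α β α' : ℂ} (hst : s ≠ t) (hα : α ≠ 0) (hβ : β ≠ 0) :
    α • e s + β • e t ≠ (α' • e s' : V n) := by
  intro h
  have h1 := congrArg (fun v : V n => v s) h
  have h2 := congrArg (fun v : V n => v t) h
  simp only [PiLp.smul_apply, PiLp.add_apply, e_apply, smul_eq_mul, if_true, hst, hst.symm,
    if_false, mul_one, mul_zero, add_zero, zero_add] at h1 h2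
  by_cases h3 : s = s'
  · subst h3
    simp [hst.symm] at h2
    exact hβ h2
  · simp [h3] at h1
    exact hα h1

/-- The combinatorial data on which the stabiliser of `Δ₀ ∪ Δ̃` depends: the block and the rank of
each index, the odd order `h` of `γ`, the order `k` of `θ`, the quotient `d = m / p`, and `ζ`.
The proposition `single` stands for `p ≠ m`, when `Δ₀` contains multiples of basis vectors, and
`big` for the nontriviality of `P₀`. The field `exception` says that `m = p = 2` and `e = 1`, for
`e = gcd(p, n₁, …, n_d)`, cannot hold if `Λ₀` has exactly two elements. -/
structure RootDatum (n : ℕ) where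
  blk : Fin n → ℕ
  ρ : Fin n → ℕ
  rank : IsRank blk ρ
  h : ℕ
  odd : Odd h
  k : ℕ
  k_ne : k ≠ 0
  d : ℕ
  coprime : Nat.Coprime d k
  ζ : ℂ
  ζ_ne_zero : ζ ≠ 0
  ζ_ne_one : ζ ≠ 1
  single : Prop
  d_eq : ¬single → d = 1
  big : Prop
  big_iff : big ↔ single ∨ ∃ i, blk i = 0 ∧ ρ i = 1
  nonempty : ∃ i, blk i = 0
  exception : ζ ^ k = 1 → ζ ^ 2 = 1 → ∀ i, blk i = 0 → ρ i = 1 →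
    single ∨ ∃ j, blk j = 0 ∧ ρ j = 2

namespace RootDatum
variable (D : RootDatum n)

/-- `α • e s + β • e t` is a root in the set attached to `D`, where `t` follows `s` in a block. -/
def IsPair (s t : Fin n) (α β : ℂ) : Prop :=
  D.blk s = D.blk t ∧ D.ρ t = D.ρ s + 1 ∧
    (D.blk s ≠ 0 → α ^ D.h = 1 ∧ β = -α) ∧
    (D.blk s = 0 → D.ρ s = 0 → α ^ D.k = 1 ∧ (β = -1 ∨ β = -D.ζ)) ∧
    (D.blk s = 0 → D.ρ s ≠ 0 → α = 1 ∧ β = -1)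

/-- `α • e s` is a root in the set attached to `D`. -/
def IsSingle (s : Fin n) (α : ℂ) : Prop :=
  D.single ∧ D.blk s = 0 ∧ (D.ρ s = 0 → α ^ D.k = 1) ∧ (D.ρ s ≠ 0 → α = 1)

/-- The set of roots attached to `D`; it is `Δ₀ ∪ Δ̃`. -/
def roots : Set (V n) :=
  {v | ∃ s t α β, D.IsPair s t α β ∧ v = α • e s + β • e t} ∪
    {v | ∃ s α, D.IsSingle s α ∧ v = α • e s}

variable {D}

lemma IsPair.ne {s t : Fin n} {α β : ℂ} (h : D.IsPair s t α β) : s ≠ t := by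
  rintro rfl
  have := h.2.1
  omega

lemma IsPair.ne_zero {s t : Fin n} {α β : ℂ} (h : D.IsPair s t α β) : α ≠ 0 ∧ β ≠ 0 := by
  obtain ⟨-, -, h1, h2, h3⟩ := h
  by_cases hs : D.blk s = 0
  · by_cases hr : D.ρ s = 0
    · obtain ⟨h4, h5⟩ := h2 hs hr
      refine ⟨fun h0 => ?_, ?_⟩
      · rw [h0, zero_pow D.k_ne] at h4
        exact zero_ne_one h4
      · rcases h5 with rfl | rfl <;> simp [D.ζ_ne_zero]
    · obtain ⟨rfl, rfl⟩ := h3 hs hr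
      simp
  · obtain ⟨h4, rfl⟩ := h1 hs
    have : α ≠ 0 := fun h0 => by
      rw [h0, zero_pow D.odd.pos.ne'] at h4
      exact zero_ne_one h4
    simp [this]

variable (D) in
lemma exists_isPair {s t : Fin n} (h1 : D.blk s = D.blk t) (h2 : D.ρ t = D.ρ s + 1) :
    D.IsPair s t 1 (-1) :=
  ⟨h1, h2, by simp, by simp, by simp⟩

variable {g : U n} {σ : Equiv.Perm (Fin n)} {θ : Fin n → ℂ}

/-- The permutation and the coefficients of a monomial map carry pairs to pairs. -/
def MapsPairs (D : RootDatum n) (σ : Equiv.Perm (Fin n)) (θ : Fin n → ℂ) : Prop :=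
  (∀ s t α β, D.IsPair s t α β → D.IsPair (σ s) (σ t) (θ s * α) (θ t * β) ∨
    D.IsPair (σ t) (σ s) (θ t * β) (θ s * α)) ∧
  ∀ s α, D.IsSingle s α → D.IsSingle (σ s) (θ s * α)

lemma IsSingle.ne_zero {s : Fin n} {α : ℂ} (h : D.IsSingle s α) : α ≠ 0 := by
  rintro rfl
  by_cases hr : D.ρ s = 0
  · have := h.2.2.1 hr
    rw [zero_pow D.k_ne] at this
    exact zero_ne_one this
  · exact zero_ne_one (h.2.2.2 hr)

/-- A vector determines its support and its coefficients, so that the condition on the roots can be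
read off from `σ` and `θ`. -/
lemma mapsPairs_of_mapsTo (hg : IsMonomial g σ θ) (H : ∀ v ∈ D.roots, g v ∈ D.roots) :
    D.MapsPairs σ θ := by
  constructor
  · intro s t α β hp
    have h1 := H _ (Or.inl ⟨s, t, α, β, hp, rfl⟩)
    have hne : σ s ≠ σ t := fun h => hp.ne (σ.injective h)
    have ha : θ s * α ≠ 0 := mul_ne_zero (hg.ne_zero s) hp.ne_zero.1
    have hb : θ t * β ≠ 0 := mul_ne_zero (hg.ne_zero t) hp.ne_zero.2
    rw [map_add, map_smul, map_smul, hg, hg, smul_smul, smul_smul, mul_comm α, mul_comm β] at h1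
    rcases h1 with ⟨s', t', α', β', hp', h2⟩ | ⟨s', α', -, h2⟩
    · rcases pair_eq_pair hne hp'.ne ha hb h2 with ⟨h3, h4, h5, h6⟩ | ⟨h3, h4, h5, h6⟩
      · rw [h3, h4, h5, h6]
        exact Or.inl hp'
      · rw [h3, h4, h5, h6]
        exact Or.inr hp'
    · exact absurd h2 (pair_ne_single hne ha hb)
  · intro s α hp
    have h1 := H _ (Or.inr ⟨s, α, hp, rfl⟩)
    have ha : θ s * α ≠ 0 := mul_ne_zero (hg.ne_zero s) hp.ne_zero
    rw [map_smul, hg, smul_smul, mul_comm α] at h1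
    rcases h1 with ⟨s', t', α', β', hp', h2⟩ | ⟨s', α', hp', h2⟩
    · exact absurd h2.symm (pair_ne_single hp'.ne hp'.ne_zero.1 hp'.ne_zero.2)
    · obtain ⟨h3, h4⟩ := smul_e_eq ha h2
      rw [h3, h4]
      exact hp'

variable (D) in
lemma finite_roots : D.roots.Finite := by
  have hN : 0 < 2 * (D.h * D.k) :=
    Nat.mul_pos two_pos (Nat.mul_pos D.odd.pos (Nat.pos_of_ne_zero D.k_ne))
  let A : Set ℂ := {z | z ^ (2 * (D.h * D.k)) = 1} ∪ {-D.ζ, 0}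
  have hA : A.Finite := by
    refine Set.Finite.union ?_ (by simp)
    refine (Polynomial.nthRootsFinset (2 * (D.h * D.k)) (1 : ℂ)).finite_toSet.subset fun z hz => ?_
    simpa [Polynomial.mem_nthRootsFinset hN] using hz
  have h1 : ∀ z : ℂ, z ^ D.h = 1 → z ^ (2 * (D.h * D.k)) = 1 := fun z hz => by
    rw [mul_left_comm, pow_mul, hz, one_pow]
  have h2 : ∀ z : ℂ, z ^ D.k = 1 → z ^ (2 * (D.h * D.k)) = 1 := fun z hz => by
    rw [← mul_assoc, mul_comm, pow_mul, hz, one_pow]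
  have h3 : ∀ z : ℂ, z ^ (2 * (D.h * D.k)) = 1 → (-z) ^ (2 * (D.h * D.k)) = 1 := fun z hz => by
    rw [Even.neg_pow ⟨D.h * D.k, two_mul _⟩, hz]
  have hone : (1 : ℂ) ∈ A := Or.inl (one_pow _)
  have hneg : (-1 : ℂ) ∈ A := Or.inl (h3 _ (one_pow _))
  refine (((Set.finite_univ (α := Fin n)).prod (Set.finite_univ (α := Fin n))).prod
    (hA.prod hA)).image (fun x => x.2.1 • e x.1.1 + x.2.2 • (e x.1.2 : V n)) |>.subset ?_
  rintro v (⟨s, t, α, β, hp, rfl⟩ | ⟨s, α, hp, rfl⟩)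
  · refine ⟨((s, t), (α, β)), ⟨⟨trivial, trivial⟩, ?_, ?_⟩, rfl⟩ <;>
      (obtain ⟨-, -, q1, q2, q3⟩ := hp; by_cases hs : D.blk s = 0)
    · by_cases hr : D.ρ s = 0
      · exact Or.inl (h2 _ (q2 hs hr).1)
      · exact (q3 hs hr).1 ▸ hone
    · exact Or.inl (h1 _ (q1 hs).1)
    · by_cases hr : D.ρ s = 0
      · rcases (q2 hs hr).2 with h | h
        · exact h ▸ hneg
        · exact h ▸ Or.inr (Or.inl rfl)
      · exact (q3 hs hr).2 ▸ hneg
    · exact (q1 hs).2 ▸ Or.inl (h3 _ (h1 _ (q1 hs).1))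
  · refine ⟨((s, s), (α, 0)), ⟨⟨trivial, trivial⟩, ?_, Or.inr (Or.inr rfl)⟩, by simp⟩
    by_cases hr : D.ρ s = 0
    · exact Or.inl (h2 _ (hp.2.2.1 hr))
    · exact hp.2.2.2 hr ▸ hone

lemma image_roots_eq (hg : IsMonomial g σ θ) (H : D.MapsPairs σ θ) : g '' D.roots = D.roots := by
  refine Set.Finite.eq_of_subset_of_encard_le (D.finite_roots.image g) ?_
    (g.injective.encard_image _).ge
  rintro _ ⟨v, hv, rfl⟩
  rcases hv with ⟨s, t, α, β, hp, rfl⟩ | ⟨s, α, hp, rfl⟩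
  · rw [map_add, map_smul, map_smul, hg, hg, smul_smul, smul_smul, mul_comm α, mul_comm β]
    rcases H.1 s t α β hp with h | h
    · exact Or.inl ⟨_, _, _, _, h, rfl⟩
    · exact Or.inl ⟨_, _, _, _, h, add_comm _ _⟩
  · rw [map_smul, hg, smul_smul, mul_comm α]
    exact Or.inr ⟨_, _, H.2 s α hp, rfl⟩

/-! ### Monomial maps compatible with the blocks -/

/-- The conditions on a monomial map under which it normalises the parabolic subgroup: it permutes
the blocks, it preserves the block of a nontrivial `P₀`, and its coefficients are constant on every
block that it does not carry to that one. -/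
structure Compatible (D : RootDatum n) (σ : Equiv.Perm (Fin n)) (θ : Fin n → ℂ) : Prop where
  blk_eq : ∀ i j, D.blk i = D.blk j → D.blk (σ i) = D.blk (σ j)
  zero : D.big → ∀ i, D.blk i = 0 → D.blk (σ i) = 0
  const : ∀ i j, D.blk i = D.blk j → ¬(D.big ∧ D.blk (σ i) = 0) → θ i = θ j

/-- A function that does not change from an index to the next is constant on blocks. -/
lemma eq_of_forall_step (D : RootDatum n) {T : Type*} (f : Fin n → T)
    (hf : ∀ s t, D.blk s = D.blk t → D.ρ t = D.ρ s + 1 → f s = f t)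
    (i j : Fin n) (hij : D.blk i = D.blk j) : f i = f j := by
  have key : ∀ r, ∀ i j, D.blk i = D.blk j → D.ρ i = D.ρ j + r → f i = f j := by
    intro r
    induction r with
    | zero => intro i j h1 h2; rw [D.rank.inj i j h1 h2]
    | succ r ih =>
      intro i j h1 h2
      have hlt := (D.rank.lt_card_iff i (D.ρ i)).2 ⟨i, rfl, rfl⟩
      obtain ⟨l, hl, hlr⟩ := (D.rank.lt_card_iff i (D.ρ j + r)).1 (by omega)
      rw [← hf l i hl (by omega), ih l j (hl.trans h1) hlr]
  rcases le_total (D.ρ j) (D.ρ i) with h | h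
  · exact key (D.ρ i - D.ρ j) i j hij (by omega)
  · exact (key (D.ρ j - D.ρ i) j i hij.symm (by omega)).symm

variable (D) in
lemma exists_rank_eq {i : Fin n} {r : ℕ} (hr : r ≤ D.ρ i) : ∃ j, D.blk j = D.blk i ∧ D.ρ j = r :=
  (D.rank.lt_card_iff i r).1 (lt_of_le_of_lt hr ((D.rank.lt_card_iff i _).2 ⟨i, rfl, rfl⟩))

lemma ρ_eq_zero_of_not_big (hbig : ¬D.big) {i : Fin n} (hi : D.blk i = 0) : D.ρ i = 0 := by
  by_contra h
  obtain ⟨j, hj, hj1⟩ := D.exists_rank_eq (i := i) (r := 1) (by omega)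
  exact hbig (D.big_iff.2 (Or.inr ⟨j, hj.trans hi, hj1⟩))

/-- The blocks are the connected components of the graph of the supports of the roots. The block with
label `0` is recognised by multiples of basis vectors or by non-proportional roots with the same
support. -/
lemma MapsPairs.compatible (H : D.MapsPairs σ θ) (hθ : ∀ i, θ i ≠ 0) : D.Compatible σ θ := by
  have hblk : ∀ i j, D.blk i = D.blk j → D.blk (σ i) = D.blk (σ j) :=
    D.eq_of_forall_step (fun i => D.blk (σ i)) fun s t h1 h2 => by
      rcases H.1 _ _ _ _ (D.exists_isPair h1 h2) with h | h
      · exact h.1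
      · exact h.1.symm
  have hzero : D.big → ∀ i, D.blk i = 0 → D.blk (σ i) = 0 := by
    intro hbig i hi
    obtain ⟨z, hz, hσz⟩ : ∃ z, D.blk z = 0 ∧ D.blk (σ z) = 0 := by
      rcases D.big_iff.1 hbig with hs | ⟨t, ht, ht1⟩
      · obtain ⟨z, hz⟩ := D.nonempty
        exact ⟨z, hz, (H.2 z 1 ⟨hs, hz, by simp, by simp⟩).2.1⟩
      · -- two roots with the same support and different ratios of coefficients
        obtain ⟨s, hs, hs0⟩ := D.exists_rank_eq (i := t) (r := 0) (by omega)
        refine ⟨s, hs.trans ht, ?_⟩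
        by_contra hne
        have hp1 := H.1 s t 1 (-1) (D.exists_isPair hs (by omega))
        have hp2 := H.1 s t 1 (-D.ζ) ⟨hs, by omega, fun h => absurd (hs.trans ht) h,
          fun _ _ => by simp, fun _ h => absurd hs0 h⟩
        have hne' : D.blk (σ t) ≠ 0 := by rwa [← hblk s t hs]
        have e1 : θ t = θ s := by
          rcases hp1 with h | h
          · simpa using (h.2.2.1 hne).2
          · simpa using (h.2.2.1 hne').2.symm
        have e2 : θ t * D.ζ = θ s := by
          rcases hp2 with h | h
          · simpa using (h.2.2.1 hne).2
          · simpa using (h.2.2.1 hne').2.symm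
        rw [← e1] at e2
        exact D.ζ_ne_one (mul_left_cancel₀ (hθ t) (by rw [e2, mul_one]))
    rw [hblk i z (hi.trans hz.symm), hσz]
  refine ⟨hblk, hzero, ?_⟩
  classical
  let f : Fin n → ℂ := fun i => if D.big ∧ D.blk (σ i) = 0 then 0 else θ i
  have hf : ∀ i j, D.blk i = D.blk j → f i = f j := D.eq_of_forall_step f fun s t h1 h2 => by
    simp only [f, ← hblk s t h1]
    split_ifs with hs
    · rfl
    · have hne : D.blk (σ s) ≠ 0 := by
        intro h0
        have hnb : ¬D.big := fun hb => hs ⟨hb, h0⟩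
        have h3 : σ s = σ t := D.rank.inj _ _ (hblk s t h1) (by
          rw [ρ_eq_zero_of_not_big hnb h0, ρ_eq_zero_of_not_big hnb ((hblk s t h1).symm.trans h0)])
        rw [σ.injective h3] at h2
        omega
      rcases H.1 _ _ _ _ (D.exists_isPair h1 h2) with h | h
      · have := (h.2.2.1 hne).2
        simpa using this.symm
      · have := (h.2.2.1 (by rwa [← hblk s t h1])).2
        simpa using this
  intro i j hij hi
  have := hf i j hij
  simp only [f, ← hblk i j hij, if_neg hi] at this
  exact this

/-- The elements of the parabolic subgroup, for `m` and the data in `D`. If `P₀` is trivial, no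
coefficient differs from `1`, and the block with label `0` is on a par with the other blocks of
size one. -/
def IsParabolic (D : RootDatum n) (m : ℕ) (g : U n) : Prop :=
  ∃ σ θ, IsMonomial g σ θ ∧ (∀ i, θ i ^ m = 1) ∧ (∏ i, θ i) ^ D.d = 1 ∧
    (∀ i, D.blk (σ i) = D.blk i) ∧ ∀ i, ¬(D.big ∧ D.blk i = 0) → θ i = 1

lemma Compatible.isParabolic_conj {m : ℕ} (H : D.Compatible σ θ) (hg : IsMonomial g σ θ)
    (hθ : ∀ i, θ i ^ m = 1) {x : U n} (hx : D.IsParabolic m x) :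
    D.IsParabolic m (g * x * g⁻¹) := by
  obtain ⟨τ, φ, h1, h2, h3, h4, h5⟩ := hx
  refine ⟨_, _, hg.conj h1, fun i => ?_, ?_, fun i => ?_, fun i hi => ?_⟩
  · simp only [mul_pow, inv_pow, hθ, h2, inv_one, one_mul]
  · have hprod : ∏ i, ((θ (σ⁻¹ i))⁻¹ * φ (σ⁻¹ i) * θ (τ (σ⁻¹ i))) = ∏ i, φ i := by
      rw [Equiv.prod_comp σ⁻¹ (fun i => (θ i)⁻¹ * φ i * θ (τ i)), Finset.prod_mul_distrib,
        Finset.prod_mul_distrib, Equiv.prod_comp τ θ, Finset.prod_inv_distrib, mul_right_comm,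
        inv_mul_cancel₀ (Finset.prod_ne_zero_iff.2 fun i _ => hg.ne_zero i), one_mul]
    rw [hprod, h3]
  · have := H.blk_eq _ _ (h4 (σ⁻¹ i))
    simpa using this
  · obtain ⟨j, rfl⟩ := σ.surjective i
    have hj : ¬(D.big ∧ D.blk j = 0) := fun h => hi ⟨h.1, H.zero h.1 j h.2⟩
    simp only [perm_inv_apply_apply]
    rw [h5 j hj, H.const j (τ j) (h4 j).symm hi, mul_one, inv_mul_cancel₀ (hg.ne_zero _)]

/-- A monomial map that conjugates the transpositions and the diagonal elements of the parabolic
subgroup into it is compatible with the blocks. -/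
lemma compatible_of_conj {m : ℕ} (hm : m ≠ 0) (hζ : D.ζ ^ m = 1)
    (hsingle : D.single → ∃ ξ : ℂ, ξ ≠ 1 ∧ ξ ^ m = 1 ∧ ξ ^ D.d = 1) (hg : IsMonomial g σ θ)
    (H : ∀ x, D.IsParabolic m x → D.IsParabolic m (g * x * g⁻¹)) : D.Compatible σ θ := by
  have hswap : ∀ i j, D.blk i = D.blk j → D.blk (σ i) = D.blk (σ j) ∧
      (¬(D.big ∧ D.blk (σ i) = 0) → θ i = θ j) := by
    intro i j hij
    obtain ⟨s, hs⟩ := exists_swap i j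
    have hsP : D.IsParabolic m s := by
      refine ⟨_, _, hs, by simp, by simp, fun l => ?_, by simp⟩
      by_cases hl : l = i
      · simp [hl, hij]
      · by_cases hl' : l = j
        · simp [hl', hij]
        · rw [Equiv.swap_apply_of_ne_of_ne hl hl']
    obtain ⟨τ, φ, h1, -, -, h4, h5⟩ := H s hsP
    have h6 := (hg.conj hs).unique h1
    have h7 := congrArg (fun τ : Equiv.Perm (Fin n) => τ (σ i)) h6.1
    have h8 := congrFun h6.2 (σ i)
    simp only [Equiv.Perm.mul_apply, perm_inv_apply_apply, Equiv.swap_apply_left,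
      Pi.one_apply, mul_one] at h7 h8
    refine ⟨by rw [h7, h4], fun hi => ?_⟩
    rw [h5 _ hi] at h8
    have := hg.ne_zero i
    field_simp at h8
    exact h8.symm
  refine ⟨fun i j h => (hswap i j h).1, fun hbig i hi => ?_, fun i j h => (hswap i j h).2⟩
  -- a diagonal element of `P₀` with a nontrivial entry
  have hdiag : ∃ (z : Fin n) (φ : Fin n → ℂ), D.blk z = 0 ∧ φ z ≠ 1 ∧ (∀ i, φ i ^ m = 1) ∧
      (∏ i, φ i) ^ D.d = 1 ∧ ∀ i, D.blk i ≠ 0 → φ i = 1 := by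
    rcases D.big_iff.1 hbig with hs | ⟨t, ht, ht1⟩
    · obtain ⟨z, hz⟩ := D.nonempty
      obtain ⟨ξ, hξ, hξm, hξd⟩ := hsingle hs
      refine ⟨z, Function.update 1 z ξ, hz, by simpa using hξ, fun i => ?_, ?_, fun i hi => ?_⟩
      · by_cases h : i = z
        · subst h
          simpa using hξm
        · simp [h]
      · rw [Finset.prod_update_of_mem (Finset.mem_univ z)]
        simpa using hξd
      · have : i ≠ z := by
          rintro rfl
          exact hi hz
        simp [this]
    · obtain ⟨s, hs, hs0⟩ := D.exists_rank_eq (i := t) (r := 0) (by omega)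
      have hst : s ≠ t := by
        rintro rfl
        omega
      refine ⟨s, Function.update (Function.update 1 t D.ζ⁻¹) s D.ζ, hs.trans ht,
        by simpa using D.ζ_ne_one, fun i => ?_, ?_, fun i hi => ?_⟩
      · by_cases h : i = s
        · subst h
          simpa using hζ
        · by_cases h' : i = t
          · subst h'
            simp [h, hζ]
          · simp [h, h']
      · rw [Finset.prod_update_of_mem (Finset.mem_univ s),
          Finset.prod_update_of_mem (by simpa using hst.symm)]
        simp [D.ζ_ne_zero]
      · have h1 : i ≠ s := by
          rintro rfl
          exact hi (hs.trans ht)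
        have h2 : i ≠ t := by
          rintro rfl
          exact hi ht
        simp [h1, h2]
  obtain ⟨z, φ, hz, hφz, hφm, hφd, hφ1⟩ := hdiag
  obtain ⟨x, hx⟩ := exists_isMonomial (1 : Equiv.Perm (Fin n)) φ
    (fun i => Complex.norm_eq_one_of_pow_eq_one (hφm i) hm)
  obtain ⟨τ, ψ, h1, -, -, -, h5⟩ := H x ⟨1, φ, hx, hφm, hφd, fun _ => rfl,
    fun i hi => hφ1 i fun h => hi ⟨hbig, h⟩⟩
  have h8 := congrFun ((hg.conj hx).unique h1).2 (σ z)
  simp only [perm_inv_apply_apply, Equiv.Perm.one_apply] at h8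
  rw [(hswap i z (hi.trans hz.symm)).1]
  by_contra hne
  rw [h5 _ fun h => hne h.2, mul_right_comm, inv_mul_cancel₀ (hg.ne_zero _), one_mul] at h8
  exact hφz h8

end RootDatum

namespace RootDatum
variable {D : RootDatum n} {g : U n} {σ : Equiv.Perm (Fin n)} {θ : Fin n → ℂ}

/-! ### The stabiliser meets the parabolic subgroup trivially -/

/-- If consecutive indices in the blocks with nonzero label go to consecutive indices in the same
order, the permutation fixes these blocks pointwise, since it shifts all ranks in a block equally. -/
lemma apply_eq_of_step (hblk : ∀ i, D.blk (σ i) = D.blk i)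
    (hstep : ∀ s t, D.blk s = D.blk t → D.blk s ≠ 0 → D.ρ t = D.ρ s + 1 →
      D.ρ (σ t) = D.ρ (σ s) + 1) {i : Fin n} (hi : D.blk i ≠ 0) : σ i = i := by
  let f : Fin n → ℤ := fun i => if D.blk i = 0 then 0 else (D.ρ (σ i) : ℤ) - D.ρ i
  have hf := D.eq_of_forall_step f fun s t h1 h2 => by
    simp only [f, ← h1]
    split_ifs with h0
    · rfl
    · have := hstep s t h1 h0 h2
      omega
  obtain ⟨z, hz, hz0⟩ := D.exists_rank_eq (i := i) (r := 0) (by omega)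
  have hw : D.blk (σ⁻¹ z) = D.blk z := by
    have h1 := hblk (σ⁻¹ z)
    have h2 : σ (σ⁻¹ z) = z := σ.apply_symm_apply z
    rw [h2] at h1
    exact h1.symm
  have h1 := hf i z hz.symm
  have h2 := hf i (σ⁻¹ z) (hz.symm.trans hw.symm)
  have h3 : D.ρ (σ (σ⁻¹ z)) = 0 := by
    rw [show σ (σ⁻¹ z) = z from σ.apply_symm_apply z, hz0]
  simp only [f, if_neg hi, if_neg (hz ▸ hi : D.blk z ≠ 0),
    if_neg (hw ▸ hz ▸ hi : D.blk (σ⁻¹ z) ≠ 0), h3, hz0] at h1 h2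
  refine D.rank.inj _ _ (hblk i) ?_
  omega

lemma MapsPairs.isPair_first (H : D.MapsPairs σ θ) {s t : Fin n} (hs : D.blk s = 0)
    (ht : D.blk t = 0) (hs0 : D.ρ s = 0) (ht1 : D.ρ t = 1) {α β : ℂ} (hα : α ^ D.k = 1)
    (hβ : β = -1 ∨ β = -D.ζ) :
    D.IsPair (σ s) (σ t) (θ s * α) (θ t * β) ∨ D.IsPair (σ t) (σ s) (θ t * β) (θ s * α) :=
  H.1 s t α β ⟨hs.trans ht.symm, by omega, fun h => absurd hs h, fun _ _ => ⟨hα, hβ⟩,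
    fun _ h => absurd hs0 h⟩

/-- The first two indices span the only edge that supports several roots up to scalars. -/
lemma MapsPairs.first_edge (H : D.MapsPairs σ θ) (hblk : ∀ i, D.blk (σ i) = D.blk i)
    {s t : Fin n} (hs : D.blk s = 0)
    (ht : D.blk t = 0) (hs0 : D.ρ s = 0) (ht1 : D.ρ t = 1) :
    (σ s = s ∧ σ t = t) ∨ (σ s = t ∧ σ t = s) := by
  have hθ : ∀ c : ℂ, θ t * -1 = c → θ t * -D.ζ = c → c ≠ 0 → False := by
    rintro c rfl h h0
    refine D.ζ_ne_one (neg_injective (mul_left_cancel₀ ?_ h))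
    rintro h1
    simp [h1] at h0
  have hσs : D.blk (σ s) = 0 := (hblk s).trans hs
  have hσt : D.blk (σ t) = 0 := (hblk t).trans ht
  have hp1 := H.isPair_first hs ht hs0 ht1 (one_pow _) (Or.inl rfl)
  have hp2 := H.isPair_first hs ht hs0 ht1 (one_pow _) (Or.inr rfl)
  rcases hp1 with h1 | h1
  · left
    have h2 := hp2.resolve_right fun h2 => by
      have := h1.2.1
      have := h2.2.1
      omega
    by_cases h0 : D.ρ (σ s) = 0
    · have := h1.2.1
      exact ⟨D.rank.inj _ _ (hblk s) (by omega), D.rank.inj _ _ (hblk t) (by omega)⟩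
    · exact (hθ _ (h1.2.2.2.2 hσs h0).2 (h2.2.2.2.2 hσs h0).2 (by norm_num)).elim
  · right
    have h2 := hp2.resolve_left fun h2 => by
      have := h1.2.1
      have := h2.2.1
      omega
    by_cases h0 : D.ρ (σ t) = 0
    · have := h1.2.1
      exact ⟨D.rank.inj _ _ ((hblk s).trans (hs.trans ht.symm)) (by omega),
        D.rank.inj _ _ ((hblk t).trans (ht.trans hs.symm)) (by omega)⟩
    · exact (hθ _ (h1.2.2.2.2 hσt h0).1 (h2.2.2.2.2 hσt h0).1 (by norm_num)).elim

/-- If `Λ₀` has exactly two elements, they are not interchanged, outside the exceptional case. -/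
lemma MapsPairs.not_interchange (H : D.MapsPairs σ θ)
    {s t : Fin n} (hs : D.blk s = 0)
    (ht : D.blk t = 0) (hs0 : D.ρ s = 0) (ht1 : D.ρ t = 1)
    (h2 : ∀ j, D.blk j = 0 → D.ρ j ≠ 2) : ¬(σ s = t ∧ σ t = s) := by
  rintro ⟨hσs, hσt⟩
  have hp : ∀ α β : ℂ, α ^ D.k = 1 → (β = -1 ∨ β = -D.ζ) →
      (θ t * β) ^ D.k = 1 ∧ (θ s * α = -1 ∨ θ s * α = -D.ζ) := by
    intro α β hα hβ
    rcases H.isPair_first hs ht hs0 ht1 hα hβ with h | h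
    · have := h.2.1
      rw [hσs, hσt] at this
      omega
    · rw [hσs, hσt] at h
      exact h.2.2.2.1 hs hs0
  have hζk : D.ζ ^ D.k = 1 := by
    have e1 := (hp 1 (-1) (one_pow _) (Or.inl rfl)).1
    have e2 := (hp 1 (-D.ζ) (one_pow _) (Or.inr rfl)).1
    have : (θ t * -D.ζ) ^ D.k = (θ t * -1) ^ D.k * D.ζ ^ D.k := by
      rw [← mul_pow]
      ring
    rwa [this, e1, one_mul] at e2
  have hζ2 : D.ζ ^ 2 = 1 := by
    have hθ0 : θ s ≠ 0 := by
      intro h0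
      rcases (hp 1 (-1) (one_pow _) (Or.inl rfl)).2 with h | h
      · simp [h0] at h
      · rw [h0, zero_mul, eq_comm, neg_eq_zero] at h
        exact D.ζ_ne_zero h
    -- the three values `θ s`, `θ s * ζ`, `θ s * ζ ^ 2` lie in a set of two elements
    have e0 := (hp 1 (-1) (one_pow _) (Or.inl rfl)).2
    have e1 := (hp D.ζ (-1) hζk (Or.inl rfl)).2
    have e2 := (hp (D.ζ ^ 2) (-1) (by rw [← pow_mul, mul_comm, pow_mul, hζk, one_pow])
      (Or.inl rfl)).2
    have c01 : θ s * 1 ≠ θ s * D.ζ := fun h => D.ζ_ne_one (mul_left_cancel₀ hθ0 h).symm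
    have c12 : θ s * D.ζ ≠ θ s * D.ζ ^ 2 := fun h => by
      have h' := mul_left_cancel₀ hθ0 h
      rw [pow_two] at h'
      exact D.ζ_ne_one (mul_left_cancel₀ D.ζ_ne_zero (h'.symm.trans (mul_one _).symm))
    have : θ s * 1 = θ s * D.ζ ^ 2 := by
      rcases e0 with a | a <;> rcases e1 with b | b <;> rcases e2 with c | c
      all_goals first
        | exact a.trans c.symm
        | exact absurd (a.trans b.symm) c01
        | exact absurd (b.trans c.symm) c12
    exact (mul_left_cancel₀ hθ0 this).symm
  rcases D.exception hζk hζ2 t ht ht1 with hsing | ⟨j, hj, hj2⟩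
  · -- the roots that are multiples of basis vectors force `θ s = 1` and `θ s * ζ = 1`
    have hall : ∀ α : ℂ, α ^ D.k = 1 → θ s * α = 1 := fun α hα => by
      have := H.2 s α ⟨hsing, hs, fun _ => hα, fun h => absurd hs0 h⟩
      rw [hσs] at this
      exact this.2.2.2 (by omega)
    have e1 := hall 1 (one_pow _)
    have e2 := hall D.ζ hζk
    rw [mul_one] at e1
    rw [e1, one_mul] at e2
    exact D.ζ_ne_one e2
  · exact h2 j hj hj2

/-- An element of the parabolic subgroup that stabilises the roots fixes every index: in the block
with label `0` its first two indices are fixed, and the others follow by induction on the rank. -/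
lemma MapsPairs.apply_eq (H : D.MapsPairs σ θ) (hblk : ∀ i, D.blk (σ i) = D.blk i)
    (hθ : ∀ i, D.blk i ≠ 0 → θ i = 1) (i : Fin n) : σ i = i := by
  by_cases hi : D.blk i = 0
  · by_cases hex : ∃ t, D.blk t = 0 ∧ D.ρ t = 1
    · obtain ⟨t, ht, ht1⟩ := hex
      obtain ⟨s, hs, hs0⟩ := D.exists_rank_eq (i := t) (r := 0) (by omega)
      rw [ht] at hs
      have hfix : σ s = s ∧ σ t = t := by
        refine (H.first_edge hblk hs ht hs0 ht1).resolve_right fun hsw => ?_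
        by_cases h2 : ∃ j, D.blk j = 0 ∧ D.ρ j = 2
        · obtain ⟨j, hj, hj2⟩ := h2
          have hne : ∀ r, D.ρ (σ j) = r → r ≠ 1 ∧ r ≠ 0 := by
            rintro _ rfl
            constructor <;> intro h0
            · have : σ j = σ s := by
                rw [hsw.1]
                exact D.rank.inj _ _ ((hblk j).trans (hj.trans ht.symm)) (h0.trans ht1.symm)
              rw [σ.injective this] at hj2
              omega
            · have : σ j = σ t := by
                rw [hsw.2]
                exact D.rank.inj _ _ ((hblk j).trans (hj.trans hs.symm)) (h0.trans hs0.symm)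
              rw [σ.injective this] at hj2
              omega
          have hne := hne _ rfl
          rcases H.1 _ _ _ _ (D.exists_isPair (ht.trans hj.symm) (by omega)) with h | h
          · have := h.2.1
            rw [hsw.2] at this
            omega
          · have := h.2.1
            rw [hsw.2] at this
            omega
        · push Not at h2
          exact H.not_interchange hs ht hs0 ht1 h2 hsw
      have key : ∀ r, ∀ j, D.blk j = 0 → D.ρ j = r → σ j = j := by
        intro r
        induction r using Nat.strong_induction_on with
        | _ r ih =>
          intro j hj hjr
          match r, ih, hjr with
          | 0, _, hjr =>
            rw [D.rank.inj j s (hj.trans hs.symm) (hjr.trans hs0.symm), hfix.1]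
          | 1, _, hjr =>
            rw [D.rank.inj j t (hj.trans ht.symm) (hjr.trans ht1.symm), hfix.2]
          | r + 2, ih, hjr =>
            obtain ⟨l, hl, hlr⟩ := D.exists_rank_eq (i := j) (r := r + 1) (by omega)
            have hl' := ih (r + 1) (by omega) l (hl.trans hj) hlr
            rcases H.1 _ _ _ _ (D.exists_isPair hl (by omega)) with h | h
            · have := h.2.1
              rw [hl'] at this
              exact D.rank.inj _ _ (hblk j) (by omega)
            · have := h.2.1
              rw [hl'] at this
              have h3 := ih r (by omega) (σ j) ((hblk j).trans hj) (by omega)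
              exact σ.injective h3
      exact key _ i hi rfl
    · have h0 : ∀ j, D.blk j = 0 → D.ρ j = 0 := fun j hj => by
        by_contra h
        obtain ⟨l, hl, hl1⟩ := D.exists_rank_eq (i := j) (r := 1) (by omega)
        exact hex ⟨l, hl.trans hj, hl1⟩
      exact D.rank.inj _ _ (hblk i) (by rw [h0 i hi, h0 _ ((hblk i).trans hi)])
  · refine apply_eq_of_step hblk (fun s t hst hs0 hρ => ?_) hi
    rcases H.1 _ _ _ _ (D.exists_isPair hst hρ) with h | h
    · exact h.2.1
    · exfalso
      have := (h.2.2.1 (by rwa [hblk, ← hst])).1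
      rw [hθ t (by rwa [← hst]), one_mul, D.odd.neg_one_pow] at this
      norm_num at this

/-- The coefficients of a diagonal element of the parabolic subgroup that stabilises the roots are
`1`: all but that of the first index by the shape of the roots, and the remaining one because its
order divides both `d` and `k`. -/
lemma MapsPairs.eq_one (H : D.MapsPairs σ θ) (hσ : ∀ i, σ i = i) (hprod : (∏ i, θ i) ^ D.d = 1)
    (hθ : ∀ i, ¬(D.big ∧ D.blk i = 0) → θ i = 1) (i : Fin n) : θ i = 1 := by
  by_cases hbig : D.big
  swap
  · exact hθ i fun h => hbig h.1
  obtain ⟨z, hz⟩ := D.nonempty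
  obtain ⟨s, hs, hs0⟩ := D.exists_rank_eq (i := z) (r := 0) (by omega)
  rw [hz] at hs
  have hpair : ∀ t, D.blk t = 0 → D.ρ t = 1 → ∀ β : ℂ, (β = -1 ∨ β = -D.ζ) →
      θ s ^ D.k = 1 ∧ (θ t * β = -1 ∨ θ t * β = -D.ζ) := by
    intro t ht ht1 β hβ
    rcases H.isPair_first hs ht hs0 ht1 (one_pow _) hβ with h | h
    · rw [hσ, hσ, mul_one] at h
      exact h.2.2.2.1 hs hs0
    · have := h.2.1
      rw [hσ, hσ] at this
      omega
  have hsk : θ s ^ D.k = 1 := by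
    rcases D.big_iff.1 hbig with hsing | ⟨t, ht, ht1⟩
    · have := (H.2 s 1 ⟨hsing, hs, by simp, by simp⟩).2.2.1 (by rw [hσ, hs0])
      rwa [mul_one] at this
    · exact (hpair t ht ht1 (-1) (Or.inl rfl)).1
  have hstep : ∀ u v, D.blk u = D.blk v → D.blk u = 0 → D.ρ u ≠ 0 → D.ρ v = D.ρ u + 1 →
      θ u = 1 ∧ θ v = 1 := by
    intro u v huv hu hu0 hρ
    rcases H.1 _ _ _ _ (D.exists_isPair huv hρ) with h | h
    · rw [hσ, hσ] at h
      simpa using h.2.2.2.2 hu hu0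
    · have := h.2.1
      rw [hσ, hσ] at this
      omega
  have hone : ∀ t, D.blk t = 0 → D.ρ t ≠ 0 → θ t = 1 := by
    intro t ht ht0
    by_cases hsing : D.single
    · have := (H.2 t 1 ⟨hsing, ht, by simp, by simp⟩).2.2.2 (by rwa [hσ])
      rwa [mul_one] at this
    by_cases ht1 : D.ρ t = 1
    swap
    · obtain ⟨u, hu, hu1⟩ := D.exists_rank_eq (i := t) (r := D.ρ t - 1) (by omega)
      exact (hstep u t hu (hu.trans ht) (by omega) (by omega)).2
    by_cases h2 : ∃ j, D.blk j = 0 ∧ D.ρ j = 2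
    · obtain ⟨j, hj, hj2⟩ := h2
      exact (hstep t j (ht.trans hj.symm) ht ht0 (by omega)).1
    -- here `P₀` is a dihedral group, and `θ s * θ t = 1`
    have hst : s ≠ t := by
      rintro rfl
      omega
    have hmul : θ s * θ t = 1 := by
      rw [D.d_eq hsing, pow_one] at hprod
      rw [← hprod]
      refine (Fintype.prod_eq_mul s t hst fun x hx => hθ x fun h => ?_).symm
      have h3 : D.ρ x = 0 ∨ D.ρ x = 1 := by
        by_contra! hne
        obtain ⟨j, hj, hj2⟩ := D.exists_rank_eq (i := x) (r := 2) (by omega)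
        exact h2 ⟨j, hj.trans h.2, hj2⟩
      rcases h3 with h3 | h3
      · exact hx.1 (D.rank.inj _ _ (h.2.trans hs.symm) (h3.trans hs0.symm))
      · exact hx.2 (D.rank.inj _ _ (h.2.trans ht.symm) (h3.trans ht1.symm))
    rcases (hpair t ht ht1 (-1) (Or.inl rfl)).2 with h | h
    · simpa using h
    · exfalso
      have hζ : θ t = D.ζ := by simpa using h
      have hζk : D.ζ ^ D.k = 1 := by
        have := congrArg (· ^ D.k) hmul
        simpa [mul_pow, hsk, hζ] using this
      have hζ2 : D.ζ ^ 2 = 1 := by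
        rcases (hpair t ht ht1 (-D.ζ) (Or.inr rfl)).2 with h' | h'
        · rw [hζ] at h'
          linear_combination -h'
        · rw [hζ] at h'
          refine absurd (mul_left_cancel₀ D.ζ_ne_zero ?_) D.ζ_ne_one
          linear_combination -h'
      rcases D.exception hζk hζ2 t ht ht1 with h' | h'
      · exact hsing h'
      · exact h2 h'
  by_cases hi : D.blk i = 0
  · by_cases hi0 : D.ρ i = 0
    · have his : i = s := D.rank.inj _ _ (hi.trans hs.symm) (hi0.trans hs0.symm)
      have hp : ∏ i, θ i = θ s := by
        refine Fintype.prod_eq_single s fun x hx => ?_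
        by_cases hx0 : D.blk x = 0
        · exact hone x hx0 fun h => hx (D.rank.inj _ _ (hx0.trans hs.symm) (h.trans hs0.symm))
        · exact hθ x fun h => hx0 h.2
      rw [hp] at hprod
      have h1 := Nat.dvd_gcd (orderOf_dvd_of_pow_eq_one hprod) (orderOf_dvd_of_pow_eq_one hsk)
      rw [D.coprime.gcd_eq_one, Nat.dvd_one, orderOf_eq_one_iff] at h1
      rw [his, h1]
    · exact hone i hi hi0
  · exact hθ i fun h => hi h.2

/-! ### Every coset of the parabolic subgroup in its normaliser meets the stabiliser -/

/-- A root of unity `t` of order dividing `k` that makes the determinant condition hold, found by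
Bézout's identity for `d` and `k`. -/
lemma exists_pow_mul_eq_one (D : RootDatum n) {E : ℂ} (hE : (E ^ D.d) ^ D.k = 1) :
    ∃ t : ℂ, t ^ D.k = 1 ∧ (t * E) ^ D.d = 1 := by
  have hE0 : E ^ D.d ≠ 0 := fun h => by
    rw [h, zero_pow D.k_ne] at hE
    exact zero_ne_one hE
  have hbez := Nat.gcd_eq_gcd_ab D.d D.k
  rw [D.coprime.gcd_eq_one] at hbez
  refine ⟨(E ^ D.d) ^ (-(Nat.gcdA D.d D.k)), ?_, ?_⟩
  · rw [← zpow_natCast, ← zpow_mul, mul_comm, zpow_mul, zpow_natCast, hE, one_zpow]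
  · have h1 : ((E ^ D.d) ^ (-(Nat.gcdA D.d D.k))) ^ D.d = (E ^ D.d)⁻¹ := by
      rw [← zpow_natCast, ← zpow_mul]
      have : -(Nat.gcdA D.d D.k) * (D.d : ℤ) = -1 + D.k * Nat.gcdB D.d D.k := by
        push_cast at hbez
        linear_combination hbez
      rw [this, zpow_add₀ hE0, zpow_neg_one, zpow_mul, zpow_natCast, hE, one_zpow, mul_one]
    rw [mul_pow, h1, inv_mul_cancel₀ hE0]

/-- The product of coefficients that are constant on the blocks with nonzero label. -/
lemma prod_pow_eq_one {m : ℕ} (hdvd : ∀ c ≠ 0,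
      m ∣ (Finset.univ.filter fun i => D.blk i = c).card * (D.d * D.k))
    (hm : ∀ i, θ i ^ m = 1)
    (hconst : ∀ i j, D.blk i = D.blk j → D.blk i ≠ 0 → θ i = θ j) :
    ((∏ i, if D.blk i = 0 then 1 else θ i) ^ D.d) ^ D.k = 1 := by
  rw [← pow_mul, ← Finset.prod_pow,
    ← Finset.prod_fiberwise_of_maps_to (g := D.blk) (t := Finset.univ.image D.blk) (by simp)]
  refine Finset.prod_eq_one fun c hc => ?_
  obtain ⟨i, -, rfl⟩ := Finset.mem_image.1 hc
  by_cases hi : D.blk i = 0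
  · refine Finset.prod_eq_one fun j hj => ?_
    have hj' : D.blk j = 0 := (Finset.mem_filter.1 hj).2.trans hi
    simp [hj']
  · rw [Finset.prod_congr rfl (g := fun _ => θ i ^ (D.d * D.k)) fun j hj => ?_]
    · rw [Finset.prod_const, ← pow_mul, mul_comm]
      obtain ⟨l, hl⟩ := hdvd _ hi
      rw [hl, pow_mul, hm, one_pow]
    · have hj' : D.blk j = D.blk i := (Finset.mem_filter.1 hj).2
      rw [if_neg (by rwa [hj']), hconst i j hj'.symm hi]

/-- A permutation that carries blocks to blocks as `σ` does, preserving the order of a block or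
reversing it as prescribed. -/
lemma exists_perm_of_flip (hσ : ∀ i j, D.blk i = D.blk j ↔ D.blk (σ i) = D.blk (σ j))
    (flip : Fin n → Prop) (hflip : ∀ i j, D.blk i = D.blk j → (flip i ↔ flip j)) :
    ∃ τ : Equiv.Perm (Fin n), (∀ i, D.blk (τ i) = D.blk (σ i)) ∧
      (∀ i, ¬flip i → D.ρ (τ i) = D.ρ i) ∧
      ∀ i, flip i → D.ρ (τ i) + D.ρ i + 1 = (Finset.univ.filter fun j => D.blk j = D.blk i).card := by
  classical
  have hcard : ∀ i, (Finset.univ.filter fun j => D.blk j = D.blk (σ i)).card =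
      (Finset.univ.filter fun j => D.blk j = D.blk i).card := by
    intro i
    refine (Finset.card_bij (fun j _ => σ j) (fun j hj => ?_) (fun _ _ _ _ h => σ.injective h)
      fun j hj => ⟨σ⁻¹ j, ?_, σ.apply_symm_apply j⟩).symm
    · simpa [← hσ] using hj
    · have h2 : σ (σ⁻¹ j) = j := σ.apply_symm_apply j
      simp only [Finset.mem_filter, Finset.mem_univ, true_and] at hj ⊢
      rwa [hσ, h2]
  have hlt : ∀ i, D.ρ i < (Finset.univ.filter fun j => D.blk j = D.blk i).card := fun i =>
    (D.rank.lt_card_iff i _).2 ⟨i, rfl, rfl⟩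
  have key : ∀ i, ∃ j, D.blk j = D.blk (σ i) ∧ (¬flip i → D.ρ j = D.ρ i) ∧
      (flip i → D.ρ j + D.ρ i + 1 = (Finset.univ.filter fun j => D.blk j = D.blk i).card) := by
    intro i
    have hi := hlt i
    by_cases hf : flip i
    · obtain ⟨j, hj, hjr⟩ := (D.rank.lt_card_iff (σ i)
        ((Finset.univ.filter fun j => D.blk j = D.blk i).card - 1 - D.ρ i)).1
        (by rw [hcard]; omega)
      exact ⟨j, hj, fun h => absurd hf h, fun _ => by omega⟩
    · obtain ⟨j, hj, hjr⟩ := (D.rank.lt_card_iff (σ i) (D.ρ i)).1 (by rw [hcard]; omega)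
      exact ⟨j, hj, fun _ => hjr, fun h => absurd h hf⟩
  choose f h1 h2 h3 using key
  have hinj : Function.Injective f := by
    intro i j hij
    have hb : D.blk i = D.blk j := by rw [hσ, ← h1, ← h1, hij]
    refine D.rank.inj _ _ hb ?_
    by_cases hf : flip i
    · have e1 := h3 i hf
      have e2 := h3 j ((hflip i j hb).1 hf)
      rw [hij, hb] at e1
      omega
    · rw [← h2 i hf, ← h2 j fun h => hf ((hflip i j hb).2 h), hij]
  exact ⟨Equiv.ofBijective f (Finite.injective_iff_bijective.1 hinj), h1, h2, h3⟩

/-- A compatible monomial map can be modified by an element of the parabolic subgroup so that it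
stabilises the set of roots: the blocks where the coefficient `c` has `c ^ h = -1` are reversed,
and the action on the block with label `0` is replaced by a diagonal one with a single nontrivial
entry `t`. -/
lemma Compatible.exists_mapsPairs {m : ℕ} (hm : m ≠ 0) (H : D.Compatible σ θ)
    (hσ : ∀ i j, D.blk (σ i) = D.blk (σ j) → D.blk i = D.blk j)
    (hθ : ∀ i, θ i ^ m = 1) (hprod : (∏ i, θ i) ^ D.d = 1)
    (hpow : ∀ η : ℂ, η ^ m = 1 → η ^ D.h = 1 ∨ η ^ D.h = -1)
    (hkm : D.k ∣ m)
    (hdvd : ∀ c ≠ 0, m ∣ (Finset.univ.filter fun i => D.blk i = c).card * (D.d * D.k)) :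
    ∃ (τ : Equiv.Perm (Fin n)) (φ : Fin n → ℂ), D.MapsPairs τ φ ∧
      (∀ i, D.blk (τ i) = D.blk (σ i)) ∧ (∀ i, φ i ^ m = 1) ∧ (∏ i, φ i) ^ D.d = 1 ∧
      ∀ i, ¬(D.big ∧ D.blk (σ i) = 0) → φ i = θ i := by
  classical
  have hθ0 : ∀ i, θ i ≠ 0 := fun i h => by
    have := hθ i
    rw [h, zero_pow hm] at this
    exact zero_ne_one this
  have hzero : D.big → ∀ i, D.blk (σ i) = 0 → D.blk i = 0 := by
    intro hbig i hi
    obtain ⟨z, hz⟩ := D.nonempty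
    rw [hσ i z (hi.trans (H.zero hbig z hz).symm), hz]
  have hconst : ∀ i j, D.blk i = D.blk j → D.blk i ≠ 0 → θ i = θ j := fun i j hij hi =>
    H.const i j hij fun h => hi (hzero h.1 i h.2)
  obtain ⟨τ, hτ, hτ1, hτ2⟩ := exists_perm_of_flip (D := D) (σ := σ)
    (fun i j => ⟨H.blk_eq i j, hσ i j⟩) (fun i => D.blk i ≠ 0 ∧ θ i ^ D.h = -1)
    (fun i j hij => by
      by_cases hi : D.blk i = 0
      · simp [← hij, hi]
      · rw [hconst i j hij hi, hij])
  obtain ⟨t, htk, ht⟩ := D.exists_pow_mul_eq_one (prod_pow_eq_one hdvd hθ hconst)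
  obtain ⟨w, hw⟩ := D.nonempty
  obtain ⟨z, hz, hz0⟩ := D.exists_rank_eq (i := w) (r := 0) (by omega)
  rw [hw] at hz
  let φ : Fin n → ℂ := fun i =>
    if D.big ∧ D.blk i = 0 then (if i = z then t else 1) else θ i
  have hφθ : ∀ i, D.blk i ≠ 0 → φ i = θ i := fun i hi => by simp [φ, hi]
  have hφz : D.big → φ z = t := fun hb => by simp [φ, hz, hb]
  have hφ1 : D.big → ∀ i, D.blk i = 0 → i ≠ z → φ i = 1 := fun hb i hi hiz => by
    simp [φ, hi, hb, hiz]
  have hτ0 : D.big → ∀ i, D.blk i = 0 → τ i = i := fun hb i hi =>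
    D.rank.inj _ _ (by rw [hτ, H.zero hb i hi, hi]) (hτ1 i fun h => h.1 hi)
  refine ⟨τ, φ, ⟨?_, ?_⟩, hτ, ?_, ?_, ?_⟩
  · intro s u α β hp
    have hsu := hp.1
    have hρ := hp.2.1
    by_cases hs : D.blk s = 0
    · have hb : D.big := by
        by_contra hb
        have := ρ_eq_zero_of_not_big hb (hsu.symm.trans hs)
        omega
      left
      have hu : D.blk u = 0 := hsu.symm.trans hs
      rw [hτ0 hb s hs, hτ0 hb u hu, hφ1 hb u hu (by rintro rfl; omega), one_mul]
      refine ⟨hsu, hρ, fun h => absurd hs h, fun _ h0 => ?_, fun _ h0 => ?_⟩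
      · obtain rfl : s = z := D.rank.inj _ _ (hs.trans hz.symm) (h0.trans hz0.symm)
        rw [hφz hb, mul_pow, htk, one_mul]
        exact hp.2.2.2.1 hs h0
      · rw [hφ1 hb s hs (by rintro rfl; omega), one_mul]
        exact hp.2.2.2.2 hs h0
    · have hu : D.blk u ≠ 0 := by rwa [← hsu]
      obtain ⟨hα, rfl⟩ := hp.2.2.1 hs
      have hτsu : D.blk (τ s) = D.blk (τ u) := by rw [hτ, hτ, H.blk_eq _ _ hsu]
      have hne : τ s ≠ τ u := fun h => hp.ne (τ.injective h)
      have hτs : D.blk (τ s) ≠ 0 := by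
        intro h0
        by_cases hb : D.big
        · exact hs (hzero hb s (by rw [← hτ, h0]))
        · exact hne (D.rank.inj _ _ hτsu (by
            rw [ρ_eq_zero_of_not_big hb h0, ρ_eq_zero_of_not_big hb (hτsu.symm.trans h0)]))
      have hτu : D.blk (τ u) ≠ 0 := by rwa [← hτsu]
      rw [hφθ s hs, hφθ u hu, ← hconst s u hsu hs]
      rcases hpow _ (hθ s) with h1 | h1
      · left
        have hn : θ s ^ D.h ≠ -1 := by
          rw [h1]
          norm_num
        refine ⟨hτsu, ?_, fun _ => ⟨?_, by ring⟩, fun h => absurd h hτs, fun h => absurd h hτs⟩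
        · rw [hτ1 s fun h => hn h.2, hτ1 u fun h => hn (hconst s u hsu hs ▸ h.2), hρ]
        · rw [mul_pow, h1, hα, one_mul]
      · right
        refine ⟨hτsu.symm, ?_, fun _ => ⟨?_, by ring⟩, fun h => absurd h hτu, fun h => absurd h hτu⟩
        · have e1 := hτ2 s ⟨hs, h1⟩
          have e2 := hτ2 u ⟨hu, hconst s u hsu hs ▸ h1⟩
          rw [← hsu] at e2
          omega
        · rw [mul_neg, D.odd.neg_pow, mul_pow, h1, hα, mul_one, neg_neg]
  · intro s α hp
    have hb : D.big := D.big_iff.2 (Or.inl hp.1)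
    have hs := hp.2.1
    rw [hτ0 hb s hs]
    refine ⟨hp.1, hs, fun h0 => ?_, fun h0 => ?_⟩
    · obtain rfl : s = z := D.rank.inj _ _ (hs.trans hz.symm) (h0.trans hz0.symm)
      rw [hφz hb, mul_pow, htk, one_mul]
      exact hp.2.2.1 h0
    · rw [hφ1 hb s hs (by rintro rfl; omega), one_mul]
      exact hp.2.2.2 h0
  · intro i
    simp only [φ]
    split_ifs
    · obtain ⟨l, rfl⟩ := hkm
      rw [pow_mul, htk, one_pow]
    · exact one_pow _
    · exact hθ i
  · by_cases hb : D.big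
    · rw [← ht]
      congr 1
      have : ∀ i, φ i = (if i = z then t else 1) * (if D.blk i = 0 then 1 else θ i) := by
        intro i
        by_cases hi : D.blk i = 0
        · simp [φ, hb, hi]
        · have : i ≠ z := by
            rintro rfl
            exact hi hz
          simp [φ, hi, this]
      rw [Finset.prod_congr rfl fun i _ => this i, Finset.prod_mul_distrib]
      simp
    · simpa [φ, hb] using hprod
  · intro i hi
    exact if_neg fun h => hi ⟨h.1, H.zero h.1 i h.2⟩

end RootDatum

/-! ### The semidirect product -/

namespace RootDatum
variable {D : RootDatum n}

/-- For a subgroup `A` of monomial maps, the elements of which have coefficients of order dividing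
`m` and satisfy the determinant condition, the parabolic subgroup is complemented in its
normaliser by the stabiliser of the set of roots. -/
lemma isSemidirectProduct {m : ℕ} (hm : m ≠ 0) {A P : Subgroup (U n)}
    (hA : ∀ g, g ∈ A ↔ ∃ σ θ, IsMonomial g σ θ ∧ (∀ i, θ i ^ m = 1) ∧ (∏ i, θ i) ^ D.d = 1)
    (hP : ∀ g, g ∈ P ↔ D.IsParabolic m g) (hζ : D.ζ ^ m = 1)
    (hsingle : D.single → ∃ ξ : ℂ, ξ ≠ 1 ∧ ξ ^ m = 1 ∧ ξ ^ D.d = 1)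
    (hpow : ∀ η : ℂ, η ^ m = 1 → η ^ D.h = 1 ∨ η ^ D.h = -1)
    (hkm : D.k ∣ m)
    (hdvd : ∀ c ≠ 0, m ∣ (Finset.univ.filter fun i => D.blk i = c).card * (D.d * D.k)) :
    IsSemidirectProduct (A ⊓ Subgroup.normalizer (P : Set (U n))) P
      (A ⊓ setStabilizer D.roots) := by
  have hPA : P ≤ A := by
    intro g hg
    obtain ⟨σ, θ, h1, h2, h3, -⟩ := (hP g).1 hg
    exact (hA g).2 ⟨σ, θ, h1, h2, h3⟩
  have hmaps : ∀ g ∈ setStabilizer D.roots, ∀ σ θ, IsMonomial g σ θ → D.MapsPairs σ θ := by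
    intro g hg σ θ h1
    have hg' : g '' D.roots = D.roots := hg
    exact mapsPairs_of_mapsTo h1 fun v hv => hg' ▸ Set.mem_image_of_mem g hv
  have hconj : ∀ g ∈ A ⊓ setStabilizer D.roots, ∀ x ∈ P, g * x * g⁻¹ ∈ P := by
    rintro g ⟨hgA, hgS⟩ x hx
    obtain ⟨σ, θ, h1, h2, -⟩ := (hA g).1 hgA
    exact (hP _).2 (((hmaps g hgS σ θ h1).compatible h1.ne_zero).isParabolic_conj h1 h2
      ((hP x).1 hx))
  have hHN : A ⊓ setStabilizer D.roots ≤ A ⊓ Subgroup.normalizer (P : Set (U n)) := by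
    intro g hg
    refine ⟨hg.1, Subgroup.mem_normalizer_iff.2 fun x => ⟨hconj g hg x, fun h => ?_⟩⟩
    have := hconj g⁻¹ (inv_mem hg) _ h
    simpa [mul_assoc] using this
  refine ⟨le_inf hPA Subgroup.le_normalizer, hHN,
    Subgroup.normal_subgroupOf_of_le_normalizer inf_le_right, ?_⟩
  refine Subgroup.isComplement'_of_disjoint_and_mul_eq_univ ?_ ?_
  · rw [Subgroup.disjoint_def]
    rintro ⟨g, hgN⟩ hgP hgH
    rw [Subgroup.mem_subgroupOf] at hgP hgH
    obtain ⟨σ, θ, h1, h2, h3, h4, h5⟩ := (hP g).1 hgP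
    have H := hmaps g hgH.2 σ θ h1
    have hσ := H.apply_eq h4 fun i hi => h5 i fun h => hi h.2
    have hθ := H.eq_one hσ h3 h5
    exact Subtype.ext (isometry_ext fun i => by simp [h1 i, hσ i, hθ i])
  · rw [Set.eq_univ_iff_forall]
    rintro ⟨g, hgA, hgN⟩
    obtain ⟨σ, θ, h1, h2, h3⟩ := (hA g).1 hgA
    have hcompat : ∀ g ∈ A ⊓ Subgroup.normalizer (P : Set (U n)), ∀ σ θ, IsMonomial g σ θ →
        D.Compatible σ θ := by
      intro g hg σ θ h
      refine compatible_of_conj hm hζ hsingle h fun x hx => ?_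
      exact (hP _).1 ((Subgroup.mem_normalizer_iff.1 hg.2 x).1 ((hP x).2 hx))
    have H := hcompat g ⟨hgA, hgN⟩ σ θ h1
    have hinv : IsMonomial g⁻¹ σ⁻¹ fun i => (θ (σ⁻¹ i))⁻¹ := fun i => by
      have := h1.inv_apply (σ⁻¹ i)
      rwa [show σ (σ⁻¹ i) = i from σ.apply_symm_apply i] at this
    have H' := hcompat g⁻¹ (inv_mem ⟨hgA, hgN⟩) _ _ hinv
    obtain ⟨τ, φ, k1, k2, k3, k4, k5⟩ := H.exists_mapsPairs hm
      (fun i j h => by simpa only [perm_inv_apply_apply] using H'.blk_eq _ _ h) h2 h3 hpow hkm hdvd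
    obtain ⟨h, hh⟩ := exists_isMonomial τ φ
      (fun i => Complex.norm_eq_one_of_pow_eq_one (k3 i) hm)
    have hhH : h ∈ A ⊓ setStabilizer D.roots :=
      ⟨(hA h).2 ⟨τ, φ, hh, k3, k4⟩, image_roots_eq hh k1⟩
    have hhinv : IsMonomial h⁻¹ τ⁻¹ fun i => (φ (τ⁻¹ i))⁻¹ := fun i => by
      have := hh.inv_apply (τ⁻¹ i)
      rwa [show τ (τ⁻¹ i) = i from τ.apply_symm_apply i] at this
    have hx : g * h⁻¹ ∈ P := by
      refine (hP _).2 ⟨_, _, h1.mul hhinv, fun i => ?_, ?_, fun i => ?_, fun i hi => ?_⟩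
      · rw [mul_pow, inv_pow, k3, h2, inv_one, one_mul]
      · rw [Equiv.prod_comp τ⁻¹ fun i => (φ i)⁻¹ * θ i, Finset.prod_mul_distrib,
          Finset.prod_inv_distrib, mul_pow, inv_pow, k4, h3, inv_one, one_mul]
      · obtain ⟨j, rfl⟩ := τ.surjective i
        rw [Equiv.Perm.mul_apply, perm_inv_apply_apply, k2]
      · obtain ⟨j, rfl⟩ := τ.surjective i
        rw [perm_inv_apply_apply, k5 j (by rwa [← k2]), inv_mul_cancel₀ (h1.ne_zero j)]
    refine Set.mem_mul.2
      ⟨⟨g * h⁻¹, mul_mem ⟨hgA, hgN⟩ (inv_mem (hHN hhH))⟩, ?_, ⟨h, hHN hhH⟩, ?_, ?_⟩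
    · exact hx
    · exact hhH
    · ext1
      simp

end RootDatum

end ImprimitiveReflection

open ImprimitiveReflection in
theorem mainTheorem10 (m p n n₀ : ℕ) (parts : List ℕ) (ζ : ℂ)
    (F : IntermediateField ℚ ℂ) [FiniteDimensional ℚ F] [IsAbelianGalois ℚ F]
    (γ : (NumberField.RingOfIntegers F)ˣ) (Φ Δ : Set (V n))
    (hm : 2 ≤ m) (hpm : p ∣ m) (hζ : IsPrimitiveRoot ζ m) (hζF : ζ ∈ F)
    (hn₀ : n₀ ≠ 0) (hn₀n : n₀ < n)
    (hpos : ∀ k ∈ parts, 0 < k) (hdesc : parts.Pairwise (· ≥ ·)) (hsum : n = n₀ + parts.sum)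
    (hyp2 : Hypothesis2 F γ)
    (hΦ : IsRealRootSystem (P₁ n n₀ parts) Φ) (hyp1 : Φ ⊆ rootsOf F m p (P₁ n n₀ parts))
    (hΔ : IsSimpleSystem Φ Δ)
    (hcop : Nat.Coprime (m / p) (p / gcdParts p parts))
    (hexc : ¬ (m = 2 ∧ p = 2 ∧ n₀ = 2 ∧ gcdParts p parts = 1)) :
    IsSemidirectProduct
      (G m p n ⊓ Subgroup.normalizer (standardParabolic m p n n₀ parts : Set (U n)))
      (standardParabolic m p n n₀ parts)
      (G m p n ⊓
        setStabilizer (Δ₀ m p n n₀ (gcdParts p parts) ζ ∪ extend F γ Δ)) := by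
  have hm0 : m ≠ 0 := by omega
  obtain ⟨blk, hb⟩ := exists_isBlockLabel hsum
  obtain ⟨ρ, hρ, hext⟩ := exists_rank_extend hyp2 hb hΦ hyp1 hΔ
  have hp0 : p ≠ 0 := by
    rintro rfl
    exact hm0 (Nat.eq_zero_of_zero_dvd hpm)
  have hqdvd := fun (c : ℕ) (hc : c ≠ 0) => hb.gcdParts_dvd_card hsum p hc
  have hqp := (gcdParts_dvd p parts).1
  set q := gcdParts p parts
  have hq0 : q ≠ 0 := by
    intro h
    rw [h] at hqp
    exact hp0 (Nat.eq_zero_of_zero_dvd hqp)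
  have hk0 : p / q ≠ 0 := (Nat.div_pos (Nat.le_of_dvd (Nat.pos_of_ne_zero hp0) hqp)
    (Nat.pos_of_ne_zero hq0)).ne'
  have hpq : p / q * q = p := Nat.div_mul_cancel hqp
  have hmp : m / p * p = m := Nat.div_mul_cancel hpm
  have hple : p ≤ m := Nat.le_of_dvd (by omega) hpm
  let D : RootDatum n :=
    { blk := blk
      ρ := ρ
      rank := hρ
      h := orderOf γ
      odd := hyp2.odd
      k := p / q
      k_ne := hk0
      d := m / p
      coprime := hcop
      ζ := ζ
      ζ_ne_zero := hζ.ne_zero hm0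
      ζ_ne_one := hζ.ne_one (by omega)
      single := p ≠ m
      d_eq := fun h => by
        rw [not_not.1 h]
        exact Nat.div_self (by omega)
      big := p ≠ m ∨ ∃ i, blk i = 0 ∧ ρ i = 1
      big_iff := Iff.rfl
      nonempty := ⟨⟨0, by omega⟩, (hb.zero_iff _).2 (Nat.pos_of_ne_zero hn₀)⟩
      exception := fun h1 h2 i hi hi1 => by
        have h3 : m = 2 := le_antisymm (Nat.le_of_dvd two_pos (hζ.dvd_of_pow_eq_one _ h2)) hm
        have h4 := Nat.le_of_dvd (Nat.pos_of_ne_zero hk0) (hζ.dvd_of_pow_eq_one _ h1)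
        have h5 : p / q ≤ p := Nat.div_le_self p q
        have hp2 : p = 2 := by omega
        have hk2 : p / q = 2 := by omega
        have hq1 : q = 1 := by
          rw [hk2] at hpq
          omega
        have hi' := (hb.zero_iff i).1 hi
        rw [← hρ.val i hi, hi1] at hi'
        have hn2 : n₀ ≠ 2 := fun h => hexc ⟨h3, hp2, h, hq1⟩
        have h0 : blk (⟨2, by omega⟩ : Fin n) = 0 := (hb.zero_iff _).2 (by simp; omega)
        exact Or.inr ⟨_, h0, hρ.val _ h0⟩ }
  have hθ : IsPrimitiveRoot (ζ ^ (m * q / p)) (p / q) := by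
    refine hζ.pow (by omega) ?_
    rw [Nat.mul_comm m q, Nat.mul_div_assoc q hpm]
    calc m = m / p * (p / q * q) := by rw [hpq, hmp]
      _ = _ := by ring
  have hne : NeZero (p / q) := ⟨hk0⟩
  have hθpow : ∀ j, ((ζ ^ (m * q / p)) ^ j) ^ (p / q) = 1 := fun j => by
    rw [← pow_mul, mul_comm j, pow_mul, hθ.pow_eq_one, one_pow]
  have hroots : Δ₀ m p n n₀ q ζ ∪ extend F γ Δ = D.roots := by
    rw [hext]
    have hblk0 : ∀ i : Fin n, i.val < n₀ → blk i = 0 ∧ ρ i = i.val := fun i hi =>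
      ⟨(hb.zero_iff i).2 hi, hρ.val i ((hb.zero_iff i).2 hi)⟩
    ext v
    constructor
    · rintro ((((⟨a, b, ha, hb1, hbn, j, -, hv⟩ | ⟨a, b, ha, hab, hbn, rfl⟩) |
        ⟨hs, a, ha, j, -, rfl⟩) | ⟨hs, b, hb1, hbn, rfl⟩) | ⟨i, j, y, h1, h2, h3, h4, rfl⟩)
      · obtain ⟨a0, a1⟩ := hblk0 a (by omega)
        obtain ⟨b0, b1⟩ := hblk0 b hbn
        rcases hv with rfl | rfl
        · refine Or.inl ⟨a, b, _, -1, ⟨a0.trans b0.symm, show ρ b = ρ a + 1 by omega,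
            fun h => absurd a0 h, fun _ _ => ⟨hθpow j, Or.inl rfl⟩,
            fun _ h => absurd (a1.trans ha) h⟩, by simp [sub_eq_add_neg]⟩
        · refine Or.inl ⟨a, b, _, -ζ, ⟨a0.trans b0.symm, show ρ b = ρ a + 1 by omega,
            fun h => absurd a0 h, fun _ _ => ⟨hθpow j, Or.inr rfl⟩,
            fun _ h => absurd (a1.trans ha) h⟩, by simp [sub_eq_add_neg]⟩
      · obtain ⟨a0, a1⟩ := hblk0 a (by omega)
        obtain ⟨b0, b1⟩ := hblk0 b hbn
        exact Or.inl ⟨a, b, 1, -1, D.exists_isPair (a0.trans b0.symm)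
          (show ρ b = ρ a + 1 by omega), by simp [sub_eq_add_neg]⟩
      · obtain ⟨a0, a1⟩ := hblk0 a (by omega)
        exact Or.inr ⟨a, _, ⟨hs, a0, fun _ => hθpow j, fun h => absurd (a1.trans ha) h⟩, rfl⟩
      · obtain ⟨b0, b1⟩ := hblk0 b hbn
        exact Or.inr ⟨b, 1, ⟨hs, b0, fun _ => one_pow _, fun _ => rfl⟩, by simp⟩
      · exact Or.inl ⟨i, j, y, -y, ⟨h1, h3, fun _ => ⟨h4, rfl⟩, fun h => absurd h h2,
          fun h => absurd h h2⟩, by simp [sub_eq_add_neg]⟩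
    · rintro (⟨s, t, α, β, ⟨h1, h2, h3, h4, h5⟩, rfl⟩ | ⟨s, α, ⟨h1, h2, h3, h4⟩, rfl⟩)
      · change blk s = blk t at h1
        change ρ t = ρ s + 1 at h2
        by_cases hs : blk s = 0
        · have ht := h1.symm.trans hs
          have s1 := hρ.val s hs
          have t1 := hρ.val t ht
          have tn := (hb.zero_iff t).1 ht
          refine Or.inl (Or.inl (Or.inl ?_))
          by_cases hs0 : ρ s = 0
          · obtain ⟨hα, hβ⟩ := h4 hs hs0
            obtain ⟨j, hj, rfl⟩ := hθ.eq_pow_of_pow_eq_one hα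
            refine Or.inl ⟨s, t, by omega, by omega, tn, j, hj, ?_⟩
            rcases hβ with rfl | rfl
            · left
              simp [sub_eq_add_neg]
            · right
              simp [sub_eq_add_neg, D]
          · obtain ⟨rfl, rfl⟩ := h5 hs hs0
            exact Or.inr ⟨s, t, by omega, by omega, tn, by simp [sub_eq_add_neg]⟩
        · obtain ⟨hα, rfl⟩ := h3 hs
          exact Or.inr ⟨s, t, α, h1, hs, h2, hα, by simp [sub_eq_add_neg]⟩
      · change blk s = 0 at h2
        have s1 := hρ.val s h2
        have sn := (hb.zero_iff s).1 h2
        by_cases hs0 : ρ s = 0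
        · obtain ⟨j, hj, rfl⟩ := hθ.eq_pow_of_pow_eq_one (h3 hs0)
          exact Or.inl (Or.inl (Or.inr ⟨h1, s, by omega, j, hj, rfl⟩))
        · obtain rfl := h4 hs0
          exact Or.inl (Or.inr ⟨h1, s, by omega, sn, by simp⟩)
  rw [hroots]
  refine RootDatum.isSemidirectProduct hm0 (fun g => ?_) (fun g => ?_) hζ.pow_eq_one
    (fun hs => ⟨ζ ^ p, fun h => ?_, ?_, ?_⟩)
    (fun η hη => hyp2.pow_orderOf_of_pow_eq_one hm0 hζ hζF hη)
    ((Nat.div_dvd_of_dvd hqp).trans hpm) (fun c hc => ?_)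
  · constructor
    · rintro ⟨σ, θ, h1, h2, -, h4⟩
      exact ⟨σ, θ, h4, h1, h2⟩
    · rintro ⟨σ, θ, h1, h2, h3⟩
      exact ⟨σ, θ, h2, h3, fun i hi => absurd (Set.mem_univ i) hi, h1⟩
  · rw [hb.mem_standardParabolic_iff hm0]
    constructor
    · rintro ⟨σ, θ, h1, h2, h3, h4, h5⟩
      refine ⟨σ, θ, h1, h2, h3, h4, fun i hi => ?_⟩
      by_cases hi0 : blk i = 0
      · -- if `P₀` is trivial, then `n₀ = 1` and the determinant condition determines `θ i`
        have hbig : ¬D.big := fun h => hi ⟨h, hi0⟩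
        have hd : m / p = 1 := D.d_eq fun h => hbig (Or.inl h)
        have hprod : ∏ j, θ j = θ i := by
          refine Fintype.prod_eq_single i fun j hj => h5 j fun hj0 => hj ?_
          exact hρ.inj _ _ (hj0.trans hi0.symm)
            ((RootDatum.ρ_eq_zero_of_not_big hbig hj0).trans
              (RootDatum.ρ_eq_zero_of_not_big hbig hi0).symm)
        rwa [hd, pow_one, hprod] at h3
      · exact h5 i hi0
    · rintro ⟨σ, θ, h1, h2, h3, h4, h5⟩
      exact ⟨σ, θ, h1, h2, h3, h4, fun i hi => h5 i fun h => hi h.2⟩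
  · exact hs (Nat.dvd_antisymm hpm (hζ.dvd_of_pow_eq_one _ h))
  · rw [← pow_mul, mul_comm, pow_mul, hζ.pow_eq_one, one_pow]
  · change (ζ ^ p) ^ (m / p) = 1
    rw [← pow_mul, mul_comm, hmp, hζ.pow_eq_one]
  · obtain ⟨l, hl⟩ := hqdvd c hc
    refine ⟨l, ?_⟩
    change (Finset.univ.filter fun i => blk i = c).card * (m / p * (p / q)) = m * l
    rw [hl]
    calc q * l * (m / p * (p / q)) = m / p * (p / q * q) * l := by ring
      _ = m * l := by rw [hpq, hmp]
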